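/- Let $M$ be a connected smooth $4$-manifold immersed in $\mathbb R^n$, with induced metric, tangent spaces $T_pM\subset\mathbb R^n$ and second fundamental form $\operatorname{II}$, and let $|\operatorname{II}_p|=\{\nu\cdot\operatorname{II}_p : \nu\in N_pM\}$. Suppose that $M$ is austere (for every normal vector $\nu$ the eigenvalues of $\nu\cdot \operatorname{II}$, with multiplicity, are symmetric about $0$), and that it has normal rank $\delta\ge 1$, i.e. $\dim|\operatorname{II}_p|=\delta$ for all $p$ in an open dense subset of $M$. Suppose that $M$ is of Type A: it carries a smooth orthogonal almost complex structure $\mathrm J$ such that every $T_pM$ has an orthonormal basis in which $\mathrm J$ is represented by $$\begin{bmatrix} 0&-1&0&0\\1&0&0&0\\0&0&0&-1\\0&0&1&0\end{bmatrix}$$ and in which all elements of $|\operatorname{II}_p|$ are represented by symmetric matrices that anticommute with this matrix. If $\delta\le 2$, suppose moreover that $\nabla \mathrm J=0$, i.e. that the metric of $M$ is Kähler with respect to $\mathrm J$ (for $\delta\geq 3$ this is not assumed). Suppose finally that $M$ is $2$-ruled: there is a smooth field $E$ of $2$-planes $E_p\subset T_pM$ such that near each $p$ the submanifold contains an open piece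 of the affine plane $p+E_p$, with $E_q=E_p$ for all points $q$ of this piece; and suppose that $\mathrm J(E)=E$. Let $\mathrm{Gr}(2,n)=SO(n)/(SO(2)\times SO(n-2))$ be the Grassmannian of oriented $2$-planes in $\mathbb R^n$, with the complex structure that it receives from its identification with the quadric $\{z\cdot z=0\}\subset\mathbb{CP}^{n-1}$, where a plane with positive orthonormal basis $(e_1,e_2)$ corresponds to $[e_1-\mathrm i e_2]$. Then the map $\gamma_E:M\to \mathrm{Gr}(2,n)$, sending $p$ to the plane through the origin parallel to $E_p$ and oriented by $\mathrm J$ (that is, $(e,\mathrm Je)$ is positive for $0\neq e\in E_p$), is well defined, smooth, and holomorphic with respect to $\mathrm J$: its expression $h$ in each affine coordinate of $\mathbb{CP}^{n-1}$ satisfies $dh(\mathrm JX)=\mathrm i\,dh(X)$ for all tangent vectors $X$. -/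

import Mathlib

open scoped Manifold ContDiff RealInnerProductSpace

/-- Euclidean `n`-space. -/
abbrev Euc (n : ℕ) : Type := EuclideanSpace ℝ (Fin n)

noncomputable section

namespace Austere

section Submanifold

variable {n : ℕ} {M : Type*} [TopologicalSpace M] [ChartedSpace (Euc 4) M]

/-- The differential at `p` of an `F`-valued function on the 4-manifold `M`: `D f p X = D_X f`. -/
def D {F : Type*} [NormedAddCommGroup F] [NormedSpace ℝ F] (f : M → F) (p : M) :
    TangentSpace 𝓘(ℝ, Euc 4) p →L[ℝ] F :=
  mfderiv 𝓘(ℝ, Euc 4) 𝓘(ℝ, F) f p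

/-- `f : M → ℝⁿ` exhibits the 4-manifold `M` as a smooth (immersed) submanifold of `ℝⁿ`. -/
def IsSubmanifold (f : M → Euc n) : Prop :=
  ContMDiff 𝓘(ℝ, Euc 4) 𝓘(ℝ, Euc n) ∞ f ∧ ∀ p, Function.Injective (D f p)

/-- The tangent space of the submanifold at `p`, as a linear subspace of `ℝⁿ`. -/
def tangentPlane (f : M → Euc n) (p : M) : Submodule ℝ (Euc n) :=
  LinearMap.range (D f p).toLinearMap

/-- The second fundamental form `II_p(X, Y)`: the normal part of the Euclidean derivative
`D_X (df(Ỹ))`, where `Ỹ` extends `Y` with constant coefficients in the chart at `p`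
(the chart through which Mathlib identifies `TangentSpace 𝓘(ℝ, Euc 4) p` with `Euc 4`). -/
def secondFundForm (f : M → Euc n) (p : M) (X Y : TangentSpace 𝓘(ℝ, Euc 4) p) : Euc n :=
  (tangentPlane f p)ᗮ.starProjection
    (fderiv ℝ (fderiv ℝ (f ∘ (chartAt (Euc 4) p).symm)) (chartAt (Euc 4) p p) X Y)

/-- The space `|II_p|` of all quadratic forms `ν · II_p`, for `ν` a normal vector at `p`. -/
def secondFormSpace (f : M → Euc n) (p : M) :
    Submodule ℝ (TangentSpace 𝓘(ℝ, Euc 4) p → TangentSpace 𝓘(ℝ, Euc 4) p → ℝ) :=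
  Submodule.span ℝ {B | ∃ ν ∈ (tangentPlane f p)ᗮ, B = fun X Y => ⟪secondFundForm f p X Y, ν⟫}

/-- The submanifold has normal rank `δ`: `dim |II_p| = δ` for all `p` in an open dense set. -/
def HasNormalRank (f : M → Euc n) (δ : ℕ) : Prop :=
  ∃ U : Set M, IsOpen U ∧ Dense U ∧ ∀ p ∈ U, Module.finrank ℝ (secondFormSpace f p) = δ

/-- `b` is an orthonormal basis of the 4-dimensional tangent space at `p`. -/
def IsOrthonormalFrame (f : M → Euc n) (p : M)
    (b : Fin 4 → TangentSpace 𝓘(ℝ, Euc 4) p) : Prop :=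
  Orthonormal ℝ (fun i => D f p (b i))

/-- The matrix of `ν · II_p` in the basis `b`. -/
def secondFormMatrix (f : M → Euc n) (p : M) (b : Fin 4 → TangentSpace 𝓘(ℝ, Euc 4) p)
    (ν : Euc n) : Matrix (Fin 4) (Fin 4) ℝ :=
  Matrix.of fun i j => ⟪secondFundForm f p (b i) (b j), ν⟫

/-- Austere: in every normal direction, the eigenvalues of the second fundamental form
(counted with multiplicity) are symmetrically arranged around zero. -/
def IsAustere (f : M → Euc n) : Prop :=
  ∀ p, ∀ b, IsOrthonormalFrame f p b → ∀ ν ∈ (tangentPlane f p)ᗮ,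
    (secondFormMatrix f p b ν).charpoly = (-secondFormMatrix f p b ν).charpoly

/-- A smooth orthogonal almost complex structure on the submanifold. The endomorphism of the
tangent space at `p` is encoded as an endomorphism of `ℝⁿ` that vanishes on the normal space. -/
structure IsOrthogonalComplexStructure (f : M → Euc n) (J : M → Euc n →L[ℝ] Euc n) : Prop where
  smooth : ContMDiff 𝓘(ℝ, Euc 4) 𝓘(ℝ, Euc n →L[ℝ] Euc n) ∞ J
  normal : ∀ p, ∀ v ∈ (tangentPlane f p)ᗮ, J p v = 0
  tangent : ∀ p, ∀ v ∈ tangentPlane f p, J p v ∈ tangentPlane f p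
  sq : ∀ p, ∀ v ∈ tangentPlane f p, J p (J p v) = -v
  isometry : ∀ p, ∀ v ∈ tangentPlane f p, ‖J p v‖ = ‖v‖

/-- The standard complex structure on `ℝ⁴`. -/
def stdJ : Matrix (Fin 4) (Fin 4) ℝ :=
  !![0, -1, 0, 0; 1, 0, 0, 0; 0, 0, 0, -1; 0, 0, 1, 0]

/-- The maximal austere subspace of Type A: symmetric matrices that anticommute with `stdJ`. -/
def QA : Set (Matrix (Fin 4) (Fin 4) ℝ) :=
  {S | S.IsSymm ∧ S * stdJ = -(stdJ * S)}

/-- The submanifold is of Type A with respect to `J`: at each point there is an orthonormal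
basis of the tangent space in which `J` is represented by `stdJ` and `|II_p|` lies in `QA`. -/
def IsTypeA (f : M → Euc n) (J : M → Euc n →L[ℝ] Euc n) : Prop :=
  ∀ p, ∃ b, IsOrthonormalFrame f p b ∧
    (∀ j, J p (D f p (b j)) = ∑ i, stdJ i j • D f p (b i)) ∧
    ∀ ν ∈ (tangentPlane f p)ᗮ, secondFormMatrix f p b ν ∈ QA

/-- The Levi-Civita derivative `∇_X Y` of a tangent vector field `Y` (regarded as an
`ℝⁿ`-valued function): the tangential part of the Euclidean derivative. -/
def covDeriv (f : M → Euc n) (Y : M → Euc n) (p : M) (X : TangentSpace 𝓘(ℝ, Euc 4) p) : Euc n :=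
  (tangentPlane f p).starProjection (D Y p X)

/-- `∇J = 0`; for an orthogonal `J` this says that the induced metric is Kähler
with respect to `J`. -/
def IsParallel (f : M → Euc n) (J : M → Euc n →L[ℝ] Euc n) : Prop :=
  ∀ p, ∀ X : TangentSpace 𝓘(ℝ, Euc 4) p, ∀ Y : M → Euc n,
    ContMDiffAt 𝓘(ℝ, Euc 4) 𝓘(ℝ, Euc n) ∞ Y p → (∀ q, Y q ∈ tangentPlane f q) →
      covDeriv f (fun q => J q (Y q)) p X = J p (covDeriv f Y p X)

/-- `E` is a smooth field of tangent 2-planes, and the submanifold is ruled by planes tangent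
to `E`: near each `p` it contains an open piece of the affine plane `f p + E_p`, all of whose
points `q` have `E_q = E_p`. -/
structure IsTwoRuled (f : M → Euc n) (E : M → Submodule ℝ (Euc n)) : Prop where
  finrank_eq : ∀ p, Module.finrank ℝ (E p) = 2
  le_tangent : ∀ p, E p ≤ tangentPlane f p
  smooth : ContMDiff 𝓘(ℝ, Euc 4) 𝓘(ℝ, Euc n →L[ℝ] Euc n) ∞ (fun p => (E p).starProjection)
  ruled : ∀ p, ∃ ε > 0, ∃ s : E p → M,
    ContMDiffOn 𝓘(ℝ, E p) 𝓘(ℝ, Euc 4) ∞ s (Metric.ball 0 ε) ∧ s 0 = p ∧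
      ∀ v ∈ Metric.ball (0 : E p) ε, f (s v) = f p + v ∧ E (s v) = E p

end Submanifold

/-! The Grassmannian of oriented 2-planes, as the complex quadric. -/

/-- A point of the Grassmannian `Gr(2, n) = SO(n) / (SO(2) × SO(n - 2))`: a 2-dimensional
subspace of `ℝⁿ` with an orientation, the latter given by its rotation through `+π/2`. -/
structure Gr2 (n : ℕ) where
  plane : Submodule ℝ (Euc n)
  finrank_plane : Module.finrank ℝ plane = 2
  rot : plane →ₗᵢ[ℝ] plane
  rot_rot : ∀ v, rot (rot v) = -v

namespace Gr2

variable {n : ℕ}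

/-- For `e` in the oriented plane, the isotropic vector `e - i e'` of `ℂⁿ`, where `(e, e')` is
a positive orthogonal basis with `|e| = |e'|`. -/
def isoVec (Λ : Gr2 n) (e : Λ.plane) : Fin n → ℂ :=
  fun k => ((e : Euc n) k : ℂ) - Complex.I * ((Λ.rot e : Euc n) k : ℂ)

theorem isoVec_ne_zero (Λ : Gr2 n) {e : Λ.plane} (he : e ≠ 0) : Λ.isoVec e ≠ 0 := by
  intro h
  apply he
  ext k
  have := congrArg Complex.re (congrFun h k)
  simpa [isoVec] using this

theorem exists_ne_zero (Λ : Gr2 n) : ∃ e : Λ.plane, e ≠ 0 := by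
  have : Nontrivial Λ.plane :=
    Module.nontrivial_of_finrank_pos (R := ℝ) (by rw [Λ.finrank_plane]; norm_num)
  exact exists_ne 0

/-- The identification of the oriented Grassmannian with the quadric `z · z = 0` in complex
projective space, which gives the Grassmannian its complex structure: a plane with positive
orthonormal basis `(e₁, e₂)` is sent to `[e₁ - i e₂]`. -/
def toQuadric (Λ : Gr2 n) : Projectivization ℂ (Fin n → ℂ) :=
  Projectivization.mk ℂ (Λ.isoVec Λ.exists_ne_zero.choose)
    (Λ.isoVec_ne_zero Λ.exists_ne_zero.choose_spec)

/-- `toQuadric` does not depend on the choice of the vector `e`. -/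
theorem toQuadric_eq (Λ : Gr2 n) {e : Λ.plane} (he : e ≠ 0) :
    Λ.toQuadric = Projectivization.mk ℂ (Λ.isoVec e) (Λ.isoVec_ne_zero he) := by
  have hind : LinearIndependent ℝ ![e, Λ.rot e] := by
    rw [LinearIndependent.pair_iff]
    intro a b h
    have h2 := congrArg Λ.rot h
    simp only [map_add, map_smul, Λ.rot_rot, map_zero] at h2
    have h3 : (a * a + b * b) • e = 0 := by
      have : (a * a + b * b) • e = a • (a • e + b • Λ.rot e) - b • (a • Λ.rot e + b • -e) := by
        module
      rw [this, h, h2]; simp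
    have h4 : a * a + b * b = 0 := (smul_eq_zero.mp h3).resolve_right he
    constructor <;> nlinarith [mul_self_nonneg a, mul_self_nonneg b]
  have htop := hind.span_eq_top_of_card_eq_finrank (by simp [Λ.finrank_plane])
  have hmem : Λ.exists_ne_zero.choose ∈ Submodule.span ℝ (Set.range ![e, Λ.rot e]) := by
    rw [htop]; trivial
  rw [Matrix.range_cons, Matrix.range_cons, Matrix.range_empty, Set.union_empty,
    Set.singleton_union, Submodule.mem_span_pair] at hmem
  obtain ⟨a, b, hab⟩ := hmem
  unfold toQuadric
  rw [Projectivization.mk_eq_mk_iff']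
  refine ⟨(a : ℂ) + Complex.I * b, ?_⟩
  rw [← hab]
  ext k
  simp only [isoVec, map_add, map_smul, Λ.rot_rot, Submodule.coe_add, Submodule.coe_smul,
    Submodule.coe_neg, PiLp.add_apply, PiLp.smul_apply, PiLp.neg_apply, Pi.smul_apply,
    smul_eq_mul, Complex.ofReal_add, Complex.ofReal_mul, Complex.ofReal_neg]
  linear_combination (-(b : ℂ) * ((Λ.rot e : Euc n) k : ℂ)) * Complex.I_mul_I

end Gr2

/-- The affine coordinate `z_k / z_j` on complex projective space. -/
def affineCoord {n : ℕ} (j k : Fin n) (z : Projectivization ℂ (Fin n → ℂ)) : ℂ :=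
  z.rep k / z.rep j

/-- Affine coordinates can be computed from any homogeneous coordinates. -/
theorem affineCoord_mk {n : ℕ} (j k : Fin n) (v : Fin n → ℂ) (hv : v ≠ 0) :
    affineCoord j k (Projectivization.mk ℂ v hv) = v k / v j := by
  obtain ⟨a, ha⟩ := Projectivization.exists_smul_eq_mk_rep ℂ v hv
  unfold affineCoord
  rw [← ha]
  exact mul_div_mul_left _ _ a.ne_zero

section Holomorphic

variable {n : ℕ} {M : Type*} [TopologicalSpace M] [ChartedSpace (Euc 4) M]

/-- A complex-valued function on the submanifold is holomorphic at `p` with respect to `J`: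
it is smooth at `p` and satisfies the Cauchy–Riemann equation `D_{JX} h = i D_X h` there. -/
def HolomorphicAt (f : M → Euc n) (J : M → Euc n →L[ℝ] Euc n) (h : M → ℂ) (p : M) : Prop :=
  ContMDiffAt 𝓘(ℝ, Euc 4) 𝓘(ℝ, ℂ) ∞ h p ∧
    ∀ X JX : TangentSpace 𝓘(ℝ, Euc 4) p, D f p JX = J p (D f p X) →
      D h p JX = Complex.I * D h p X

/-- A map from the submanifold to the oriented Grassmannian is holomorphic with respect to `J`:
near each point it is holomorphic in every affine chart `z_j ≠ 0` of projective space. -/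
def IsHolomorphic (f : M → Euc n) (J : M → Euc n →L[ℝ] Euc n) (γ : M → Gr2 n) : Prop :=
  ∀ p, ∀ j, (γ p).toQuadric.rep j ≠ 0 →
    ∀ k, HolomorphicAt f J (fun q => affineCoord j k (γ q).toQuadric) p

end Holomorphic

end Austere

end

/-!
The proof is extrinsic. The almost complex structure `J` (zero on normal vectors), the orthogonal
projection `Q` to the planes of the ruling, and the tangent projection `Π = -J²` are smooth
functions with values in the endomorphisms of `ℝⁿ`, and `II(X, Y) = (D_X Π) Y`
(`secondFundForm_eq`). For a fixed vector `e`, the vectors `Q e - i J Q e` are homogeneous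
coordinates of the Gauss map of the ruling, and at a point where `e ∈ E` its Cauchy-Riemann equation
reduces to `(D_{JX} Q) e = (D_X Q) (J e)` (`deriv_starProjection`). The difference of the two sides
is the obstruction `RuledJet.defect`.

Let `F` be the orthogonal complement of `E` in the tangent space. Type A means
`II(JX, Y) = II(X, JY)`, and therefore the obstruction takes values in `F`. Further, `Q` is constant
along the leaves, so `II(E, E) = 0` and `(∇_w J) e = 0` for `w, e ∈ E`. Suppose first that also
`(∇_X J) e = 0` for all tangent `X`. If `II(E, E) = 0` and the Type A condition are differentiated
and combined by the Codazzi equation, it follows that `II(e, Ψ e) = II(e, J Ψ e) = 0` for the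
obstruction `Ψ` along any vector (`RuledJet.B_defect_add`). If `Ψ e ≠ 0`, the vectors `Ψ e` and
`J Ψ e` span `F`, so `E` is in the kernel of `II` and `dim |II| ≤ 2`.

For `δ ≥ 3` this is a contradiction at the points with `dim |II| = δ`, which are dense, and `Ψ = 0`
by continuity. The vanishing of `∇J` on `E` at these points is itself a consequence of the rank
condition: the integrability condition `RuledJet.cyclic` of Type A restricts `∇J` so much that
`(∇_X J) e ≠ 0` would again give `dim |II| ≤ 2` (`RuledJet.nablaJ_eq_zero`).

For `δ ≤ 2` one has `∇J = 0`. If `Ψ ≠ 0` at a point, then it is non-zero near this point, so that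
`E` is in the kernel of `II` on an open set. Differentiating `II(·, E) = 0` and using the Codazzi
equation again shows that `Ψ e` and `J Ψ e` are in the kernel as well
(`RuledJet.B_eq_zero_of_defect_ne_zero`). Hence `II = 0` on an open set, against `δ ≥ 1`.
-/

noncomputable section

namespace Austere

/-! ### Pointwise algebra of the second fundamental form -/

section Jet

variable {W : Type*} [NormedAddCommGroup W] [InnerProductSpace ℝ W]

/-- The first order data at a point of a 2-ruled submanifold of Type A, as operators on the ambient
space `W`. `J` is the almost complex structure, zero on the normal space, so that `-J²` is the
projection to the tangent space and `J (J Y) = -Y` says that `Y` is tangent. `Q` is the projection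
to the plane `E` of the ruling; the orthogonal complement of `E` in the tangent space is called `F`.
`J' Y` and `Q' Y` are the derivatives of `J` and `Q` in the direction of the tangent part of `Y`.
`B` is the second fundamental form, extended by zero to normal vectors, and `C Y Z Z'` the normal
part of the derivative of `B` in the direction `Y`, applied to `Z` and `Z'`. -/
structure RuledJet (J Q : W →L[ℝ] W) (J' Q' : W →L[ℝ] W →L[ℝ] W)
    (B : W →L[ℝ] W →L[ℝ] W) (C : W → W → W → W) : Prop where
  skew : ∀ Y Z, ⟪J Y, Z⟫ = -⟪Y, J Z⟫
  cube : ∀ Y, J (J (J Y)) = -J Y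
  symm : ∀ Y Z, ⟪Q Y, Z⟫ = ⟪Y, Q Z⟫
  idem : ∀ Y, Q (Q Y) = Q Y
  comm : ∀ Y, Q (J Y) = J (Q Y)
  tangent : ∀ Y, J (J (Q Y)) = -Q Y
  span_E : ∀ e Z, Q e = e → e ≠ 0 → Q Z = Z → ∃ a b : ℝ, Z = a • e + b • J e
  span_F : ∀ v Z, Q v = 0 → J (J v) = -v → v ≠ 0 → Q Z = 0 → J (J Z) = -Z →
    ∃ a b : ℝ, Z = a • v + b • J v
  skew' : ∀ Y Z Z', ⟪J' Y Z, Z'⟫ = -⟪Z, J' Y Z'⟫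
  anti' : ∀ Y Z, J (J Z) = -Z → J (J (J' Y (J Z))) = J (J' Y Z)
  comm' : ∀ Y Z, Q' Y (J Z) + Q (J' Y Z) = J' Y (Q Z) + J (Q' Y Z)
  idem' : ∀ Y Z, Q Z = Z → Q (Q' Y Z) = 0
  ruled : ∀ Y, Q Y = Y → Q' Y = 0
  B_symm : ∀ Y Z, B Y Z = B Z Y
  B_J : ∀ Y Z, B (J Y) Z = B Y (J Z)
  B_proj : ∀ Y Z, B (J (J Y)) Z = -B Y Z
  B_E : ∀ Y Z, Q Y = Y → Q Z = Z → B Y Z = 0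
  normal' : ∀ Y Z, Q Z = Z → Q' Y Z + J (J (Q' Y Z)) = B Y Z
  C_symm : ∀ Y Z Z', C Y Z Z' = C Y Z' Z
  codazzi : ∀ Y Z Z', J (J Y) = -Y → J (J Z) = -Z → J (J Z') = -Z' → C Y Z Z' = C Z Y Z'
  C_E : ∀ Y Z Z', Q Z = Z → Q Z' = Z' → C Y Z Z' = -B (Q' Y Z) Z' - B Z (Q' Y Z')
  C_J : ∀ Y Z Z', C Y (J Z) Z' + B (J' Y Z) Z' = C Y Z (J Z') + B Z (J' Y Z')

namespace RuledJet

variable {J Q : W →L[ℝ] W} {J' Q' B : W →L[ℝ] W →L[ℝ] W} {C : W → W → W → W}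

theorem tangent_of_mem (h : RuledJet J Q J' Q' B C) {e : W} (he : Q e = e) : J (J e) = -e := by
  rw [← he, h.tangent]

theorem J_mem (h : RuledJet J Q J' Q' B C) {e : W} (he : Q e = e) : Q (J e) = J e := by
  rw [h.comm, he]

/-- The covariant derivative `(∇_Y J) Z` (for tangent `Y`, `Z`): the tangential part of the
derivative of `J`. -/
def nablaJ (J : W →L[ℝ] W) (J' : W →L[ℝ] W →L[ℝ] W) (Y Z : W) : W := -J (J (J' Y Z))

theorem B_normal (h : RuledJet J Q J' Q' B C) (Y Z : W) : B Y (-J (J Z)) = B Y Z := by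
  rw [h.B_symm, map_neg, _root_.neg_apply, h.B_proj, neg_neg, h.B_symm]

theorem B_nablaJ (h : RuledJet J Q J' Q' B C) (X Y Z : W) :
    B X (nablaJ J J' Y Z) = B X (J' Y Z) := h.B_normal X _

theorem J_nablaJ (h : RuledJet J Q J' Q' B C) (Y Z : W) :
    J (nablaJ J J' Y Z) = J (J' Y Z) := by
  simp [nablaJ, h.cube]

theorem tangent_nablaJ (h : RuledJet J Q J' Q' B C) (Y Z : W) :
    J (J (nablaJ J J' Y Z)) = -nablaJ J J' Y Z := by
  rw [h.J_nablaJ]; simp [nablaJ]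

/-- `∇J` anticommutes with `J`, since `J² = -1`. -/
theorem nablaJ_J (h : RuledJet J Q J' Q' B C) (Y : W) {Z : W} (hZ : J (J Z) = -Z) :
    nablaJ J J' Y (J Z) = -J (nablaJ J J' Y Z) := by
  rw [h.J_nablaJ, nablaJ, h.anti' Y Z hZ]

theorem inner_nablaJ (h : RuledJet J Q J' Q' B C) (Y : W) {Z Z' : W} (hZ' : J (J Z') = -Z') :
    ⟪nablaJ J J' Y Z, Z'⟫ = ⟪J' Y Z, Z'⟫ := by
  rw [nablaJ, inner_neg_left, h.skew, h.skew, hZ', inner_neg_right]; ring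

theorem nablaJ_skew (h : RuledJet J Q J' Q' B C) (Y : W) {Z Z' : W} (hZ : J (J Z) = -Z)
    (hZ' : J (J Z') = -Z') : ⟪nablaJ J J' Y Z, Z'⟫ = -⟪Z, nablaJ J J' Y Z'⟫ := by
  rw [h.inner_nablaJ Y hZ', h.skew', real_inner_comm, ← h.inner_nablaJ Y hZ, real_inner_comm]

theorem inner_nablaJ_self (h : RuledJet J Q J' Q' B C) (Y : W) {Z : W} (hZ : J (J Z) = -Z) :
    ⟪nablaJ J J' Y Z, Z⟫ = 0 := by
  have := h.nablaJ_skew Y hZ hZ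
  rw [real_inner_comm Z] at this
  rw [real_inner_comm]; linarith

theorem inner_nablaJ_J_self (h : RuledJet J Q J' Q' B C) (Y : W) {Z : W} (hZ : J (J Z) = -Z) :
    ⟪nablaJ J J' Y Z, J Z⟫ = 0 := by
  have h1 := h.nablaJ_skew Y hZ (h.cube Z)
  rw [h.nablaJ_J Y hZ, inner_neg_right, neg_neg, real_inner_comm, h.skew] at h1
  have h2 := h.skew (nablaJ J J' Y Z) Z
  rw [real_inner_comm] at h2
  linarith

/-- `∇J` sends `E` to its orthogonal complement. -/
theorem Q_nablaJ (h : RuledJet J Q J' Q' B C) (Y : W) {e : W} (he : Q e = e) :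
    Q (nablaJ J J' Y e) = 0 := by
  by_cases h0 : e = 0
  · subst h0; simp [nablaJ]
  have ht := h.tangent_of_mem he
  obtain ⟨a, b, hab⟩ := h.span_E e (Q (nablaJ J J' Y e)) he h0 (h.idem _)
  rw [← inner_self_eq_zero (𝕜 := ℝ)]
  nth_rewrite 2 [hab]
  rw [h.symm, map_add, map_smul, map_smul, he, h.J_mem he, inner_add_right, inner_smul_right,
    inner_smul_right, h.inner_nablaJ_self Y ht, h.inner_nablaJ_J_self Y ht]
  simp

/-- `∇J` sends the orthogonal complement `F` of `E` in the tangent space to `E`. -/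
theorem Q_nablaJ_eq_self (h : RuledJet J Q J' Q' B C) (Y : W) {v : W} (hv : Q v = 0)
    (ht : J (J v) = -v) : Q (nablaJ J J' Y v) = nablaJ J J' Y v := by
  by_cases h0 : v = 0
  · subst h0; simp [nablaJ]
  set A := nablaJ J J' Y v with hA
  have hAt := h.tangent_nablaJ Y v
  have hF : Q (A - Q A) = 0 := by rw [map_sub, h.idem, sub_self]
  obtain ⟨a, b, hab⟩ := h.span_F v (A - Q A) hv ht h0 hF
    (by rw [map_sub, map_sub, hAt, h.tangent]; abel)
  have hQ : ∀ Z, Q Z = 0 → ⟪Q A, Z⟫ = 0 := fun Z hZ => by rw [h.symm, hZ, inner_zero_right]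
  have : A - Q A = 0 := by
    rw [← inner_self_eq_zero (𝕜 := ℝ)]
    nth_rewrite 2 [hab]
    rw [inner_sub_left, inner_add_right, inner_smul_right, inner_smul_right, inner_add_right,
      inner_smul_right, inner_smul_right, hA, h.inner_nablaJ_self Y ht,
      h.inner_nablaJ_J_self Y ht, ← hA, hQ v hv, hQ (J v) (by rw [h.comm, hv, map_zero])]
    simp
  exact (sub_eq_zero.mp this).symm

theorem Q_tangent (h : RuledJet J Q J' Q' B C) (Z : W) : Q (J (J Z)) = -Q Z := by
  rw [h.comm, h.comm, h.tangent]

/-- Along the rulings, the complex structure of `E` is constant. -/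
theorem J'_ruling (h : RuledJet J Q J' Q' B C) {w e : W} (hw : Q w = w) (he : Q e = e) :
    J' w e = 0 := by
  have h1 := h.comm' w e
  rw [h.ruled w hw, he] at h1
  simp only [_root_.zero_apply, zero_add, map_zero, add_zero] at h1
  have h2 := h.Q_nablaJ w he
  rw [nablaJ, map_neg, h.Q_tangent, neg_neg, h1] at h2
  exact h2

theorem Q'_J (h : RuledJet J Q J' Q' B C) (Y : W) {e : W} (he : Q e = e) :
    Q' Y (J e) = J' Y e + J (Q' Y e) := by
  have h1 := h.comm' Y e
  have h2 := h.Q_nablaJ Y he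
  rw [nablaJ, map_neg, h.Q_tangent, neg_neg] at h2
  rwa [h2, add_zero, he] at h1

/-- The obstruction to the holomorphy of the Gauss map of `E`: for `e ∈ E` and `Y` tangent, the
difference between the derivatives of the plane `E` along `J Y` at `e` and along `Y` at `J e`. -/
def defect (J : W →L[ℝ] W) (Q' : W →L[ℝ] W →L[ℝ] W) (Y e : W) : W :=
  Q' (J Y) e - Q' Y (J e)

/-- Together with `tangent_defect`: the obstruction lies in `F`. -/
theorem Q_defect (h : RuledJet J Q J' Q' B C) (Y : W) {e : W} (he : Q e = e) :
    Q (defect J Q' Y e) = 0 := by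
  rw [defect, map_sub, h.idem' _ _ he, h.idem' _ _ (h.J_mem he), sub_zero]

/-- The normal part of the obstruction is `II(J Y, e) - II(Y, J e)`, which is zero for Type A. -/
theorem tangent_defect (h : RuledJet J Q J' Q' B C) (Y : W) {e : W} (he : Q e = e) :
    J (J (defect J Q' Y e)) = -defect J Q' Y e := by
  have h1 := h.normal' (J Y) e he
  have h2 := h.normal' Y (J e) (h.J_mem he)
  rw [h.B_J, ← h2] at h1
  rw [eq_neg_iff_add_eq_zero, defect, map_sub, map_sub]
  rw [← sub_eq_zero] at h1
  rw [← h1]; abel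

/-- The integrability condition of `II(J Y, Z) = II(Y, J Z)`: in the cyclic sum of its covariant
derivatives the terms that involve the derivative of `II` cancel, by the Codazzi equation. -/
theorem cyclic (h : RuledJet J Q J' Q' B C) {X Y Z : W} (hX : J (J X) = -X) (hY : J (J Y) = -Y)
    (hZ : J (J Z) = -Z) :
    B X (nablaJ J J' Y Z) - B X (nablaJ J J' Z Y) + (B Y (nablaJ J J' Z X) - B Y (nablaJ J J' X Z))
      + (B Z (nablaJ J J' X Y) - B Z (nablaJ J J' Y X)) = 0 := by
  simp only [h.B_nablaJ]
  have h1 := h.C_J X Y Z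
  have h2 := h.C_J Y Z X
  have h3 := h.C_J Z X Y
  rw [h.B_symm _ Z] at h1
  rw [h.B_symm _ X] at h2
  rw [h.B_symm _ Y] at h3
  have e1 : C X (J Y) Z = C Z X (J Y) := by
    rw [h.C_symm, h.codazzi X Z _ hX hZ (h.cube Y)]
  have e2 : C Y (J Z) X = C X Y (J Z) := by
    rw [h.C_symm, h.codazzi Y X _ hY hX (h.cube Z)]
  have e3 : C Z (J X) Y = C Y Z (J X) := by
    rw [h.C_symm, h.codazzi Z Y _ hZ hY (h.cube X)]
  rw [e1] at h1
  rw [e2] at h2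
  rw [e3] at h3
  have := congrArg₂ (· + ·) (congrArg₂ (· + ·) h1 h2) h3
  rw [← sub_eq_zero] at this
  rw [← this]
  abel

/-- A leaf of the ruling is a totally geodesic plane on which `J` is a constant rotation. -/
theorem nablaJ_ruling (h : RuledJet J Q J' Q' B C) {w e : W} (hw : Q w = w) (he : Q e = e) :
    nablaJ J J' w e = 0 := by
  simp [nablaJ, h.J'_ruling hw he]

/-- For `w ∈ E`, the operator `∇_w J` vanishes on `E` and sends `F` to `E`. -/
theorem Q_nablaJ_ruling (h : RuledJet J Q J' Q' B C) {w X : W} (hw : Q w = w)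
    (hX : J (J X) = -X) : Q (nablaJ J J' w X) = nablaJ J J' w X := by
  have h3 : nablaJ J J' w X = nablaJ J J' w (Q X) + nablaJ J J' w (X - Q X) := by
    simp only [nablaJ, map_sub]; abel
  rw [h3, h.nablaJ_ruling hw (h.idem X), zero_add]
  apply h.Q_nablaJ_eq_self
  · rw [map_sub, h.idem, sub_self]
  · rw [map_sub, map_sub, hX, h.tangent]; abel

/-- The cyclic identity for `X`, `e`, `J e`. -/
theorem B_ruling (h : RuledJet J Q J' Q' B C) (X : W) {e : W} (hX : J (J X) = -X)
    (he : Q e = e) : B e (J (nablaJ J J' X e)) = 0 := by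
  have hJe := h.J_mem he
  have hc := h.cyclic hX (h.tangent_of_mem he) (h.tangent_of_mem hJe)
  have hA := h.nablaJ_J X (h.tangent_of_mem he)
  rw [h.nablaJ_ruling he hJe, h.nablaJ_ruling hJe he, hA, h.B_J] at hc
  have h1 : B e (nablaJ J J' (J e) X) = 0 := h.B_E _ _ he (h.Q_nablaJ_ruling hJe hX)
  have h2 : B e (J (nablaJ J J' e X)) = 0 :=
    h.B_E _ _ he (h.J_mem (h.Q_nablaJ_ruling he hX))
  rw [h1, h.B_J, h2] at hc
  simp only [map_zero, sub_self, zero_add, map_neg, sub_neg_eq_add, sub_zero] at hc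
  rw [← two_smul ℝ] at hc
  exact (smul_eq_zero.mp hc).resolve_left two_ne_zero

/-- The cyclic identity for `X`, `Y` in `F` and `e` in `E`. -/
theorem B_nablaJ_comm (h : RuledJet J Q J' Q' B C) {X Y e : W} (hX : J (J X) = -X)
    (hY : J (J Y) = -Y) (hQX : Q X = 0) (hQY : Q Y = 0) (he : Q e = e) :
    B X (nablaJ J J' Y e) = B Y (nablaJ J J' X e) := by
  have hc := h.cyclic hX hY (h.tangent_of_mem he)
  have hE : ∀ u v, Q v = 0 → J (J v) = -v → B e (nablaJ J J' u v) = 0 := fun u v hv ht =>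
    h.B_E _ _ he (h.Q_nablaJ_eq_self u hv ht)
  have hE' : ∀ v, Q v = 0 → J (J v) = -v → nablaJ J J' e v = 0 := fun v hv ht => by
    rw [← inner_self_eq_zero (𝕜 := ℝ), h.nablaJ_skew e ht (h.tangent_nablaJ e v),
      h.nablaJ_ruling he (h.Q_nablaJ_eq_self e hv ht), inner_zero_right, neg_zero]
  rw [hE X Y hQY hY, hE Y X hQX hX, hE' Y hQY hY, hE' X hQX hX] at hc
  simpa [add_neg_eq_zero] using hc

/-- The derivative of `II(E, E) = 0` in the directions `J Y` and `Y` gives, by the Codazzi equation,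
the derivatives of `II(J Y, e')` and `II(Y, J e')` along the ruling, and these are equal by Type A.
The result is that the obstruction is skew for the pairing `II` between `E` and `F`. -/
theorem B_defect_add (h : RuledJet J Q J' Q' B C) {Y e e' : W} (hY : J (J Y) = -Y)
    (he : Q e = e) (he' : Q e' = e') (hA : ∀ e, Q e = e → nablaJ J J' Y e = 0) :
    B (defect J Q' Y e) e' + B e (defect J Q' Y e') = 0 := by
  have ht := h.tangent_of_mem he
  have ht' := h.tangent_of_mem he'
  have hQA : ∀ Z, J (J Z) = -Z → B (J' e Z) e' = 0 := fun Z hZ => by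
    rw [h.B_symm, ← h.B_nablaJ]
    exact h.B_E _ _ he' (h.Q_nablaJ_ruling he hZ)
  have h1 := h.C_J e Y e'
  rw [hQA Y hY, h.J'_ruling he he', map_zero, add_zero, add_zero,
    h.codazzi e (J Y) e' ht (h.cube Y) ht', h.codazzi e Y _ ht hY (h.cube e'),
    h.C_E _ _ _ he he', h.C_E _ _ _ he (h.J_mem he')] at h1
  have h2 : B (Q' Y (J e)) e' = B (Q' Y e) (J e') := by
    rw [h.Q'_J Y he, map_add, _root_.add_apply, h.B_J, h.B_symm (J' Y e),
      ← h.B_nablaJ, hA e he, map_zero, zero_add]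
  rw [defect, defect, map_sub, map_sub, _root_.sub_apply, h2]
  rw [← sub_eq_zero] at h1
  rw [← neg_eq_zero, ← h1]
  abel

/-- If `∇J` vanishes on `E`, the obstruction commutes with `J` modulo the kernel of `II`. -/
theorem defect_J (h : RuledJet J Q J' Q' B C) {Y e : W} (hY : J (J Y) = -Y)
    (he : Q e = e) (hA : ∀ X e, J (J X) = -X → Q e = e → nablaJ J J' X e = 0) (Z : W) :
    B Z (defect J Q' Y (J e)) = B Z (J (defect J Q' Y e)) := by
  have hB : ∀ X, J (J X) = -X → B Z (J' X e) = 0 := fun X hX => by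
    rw [← h.B_nablaJ, hA X e hX he, map_zero]
  have hJ : J (J' Y e) = 0 := by rw [← h.J_nablaJ, hA Y e hY he, map_zero]
  have hN : B Z (J (J (Q' Y e))) = - B Z (Q' Y e) := by
    have := h.B_normal Z (Q' Y e)
    rw [map_neg] at this
    rw [← this, neg_neg]
  rw [defect, defect, h.Q'_J _ he, h.tangent_of_mem he, h.Q'_J _ he]
  simp only [map_add, map_sub, map_neg, hB _ (h.cube Y), hJ, hN, map_zero]
  abel

/-- As `II(J Y, Z) = II(Y, J Z)`, the values of `II` on `E × F` are spanned by two of them. -/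
theorem B_E_eq_zero (h : RuledJet J Q J' Q' B C) {e v : W} (he : Q e = e) (he0 : e ≠ 0)
    (hv : Q v = 0) (hvt : J (J v) = -v) (hv0 : v ≠ 0) (h1 : B e v = 0) (h2 : B e (J v) = 0)
    {e' : W} (he' : Q e' = e') (Z : W) : B e' Z = 0 := by
  obtain ⟨a, b, rfl⟩ := h.span_E e e' he he0 he'
  rw [← h.B_normal]
  set Z' := -J (J Z) with hZ'
  have hZt : J (J Z') = -Z' := by simp [hZ', h.cube]
  obtain ⟨c, d, hcd⟩ := h.span_F v (Z' - Q Z') hv hvt hv0 (by rw [map_sub, h.idem, sub_self])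
    (by rw [map_sub, map_sub, hZt, h.tangent]; abel)
  have : Z' = Q Z' + (c • v + d • J v) := by rw [← hcd]; abel
  rw [this, map_add, h.B_E _ _ he' (h.idem _), zero_add]
  simp [h.B_J, h1, h2, hvt]

/-- Where `∇J` vanishes on `E`, a non-zero obstruction forces `E` into the kernel of `II`. -/
theorem B_E_eq_zero_of_defect_ne_zero (h : RuledJet J Q J' Q' B C)
    (hA : ∀ X e, J (J X) = -X → Q e = e → nablaJ J J' X e = 0) {Y e : W} (hY : J (J Y) = -Y)
    (he : Q e = e) (hne : defect J Q' Y e ≠ 0) {e' : W} (he' : Q e' = e') (Z : W) :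
    B e' Z = 0 := by
  have he0 : e ≠ 0 := by rintro rfl; exact hne (by simp [defect])
  refine h.B_E_eq_zero he he0 (h.Q_defect Y he) (h.tangent_defect Y he) hne ?_ ?_ he' Z
  · have := h.B_defect_add hY he he (fun e he => hA Y e hY he)
    rw [h.B_symm, ← two_smul ℝ] at this
    exact (smul_eq_zero.mp this).resolve_left two_ne_zero
  · have := h.B_defect_add hY he (h.J_mem he) (fun e he => hA Y e hY he)
    rw [h.defect_J hY he hA, h.B_symm, h.B_J, ← two_smul ℝ] at this
    exact (smul_eq_zero.mp this).resolve_left two_ne_zero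

/-- The values of `II` on tangent parts, which are split into their components in `E` and `F`. -/
theorem decomp (h : RuledJet J Q J' Q' B C) (X Y : W) :
    B X Y = B (Q X) (-J (J Y)) + B (-J (J X) - Q X) (Q Y) +
      B (-J (J X) - Q X) (-J (J Y) - Q Y) := by
  have : B X Y = B (-J (J X)) (-J (J Y)) := by
    rw [h.B_normal, h.B_symm (-J (J X)), h.B_normal, h.B_symm]
  rw [this]
  simp only [map_sub, map_neg, _root_.sub_apply]
  abel

theorem F_tangent (h : RuledJet J Q J' Q' B C) (X : W) :
    Q (-J (J X) - Q X) = 0 ∧ J (J (-J (J X) - Q X)) = -(-J (J X) - Q X) := by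
  constructor
  · rw [map_sub, map_neg, h.Q_tangent, h.idem, neg_neg, sub_self]
  · rw [map_sub, map_sub, map_neg, map_neg, h.cube, h.tangent]; abel

/-- If `E` lies in the kernel of `II`, then `II` takes its values in a 2-dimensional space, spanned
by `II(v, v)` and `II(v, J v)` for `v ∈ F`. -/
theorem B_mem_of_B_E_eq_zero (h : RuledJet J Q J' Q' B C)
    (hB : ∀ e Z, Q e = e → B e Z = 0) : ∃ n₁ n₂ : W, ∀ X Y, B X Y ∈ Submodule.span ℝ {n₁, n₂} := by
  by_cases hF : ∃ v, Q v = 0 ∧ J (J v) = -v ∧ v ≠ 0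
  · obtain ⟨v, hv, hvt, hv0⟩ := hF
    refine ⟨B v v, B v (J v), fun X Y => ?_⟩
    rw [h.decomp X Y, hB _ _ (h.idem X), h.B_symm _ (Q Y), hB _ _ (h.idem Y)]
    obtain ⟨a, b, h1⟩ := h.span_F v _ hv hvt hv0 (h.F_tangent X).1 (h.F_tangent X).2
    obtain ⟨c, d, h2⟩ := h.span_F v _ hv hvt hv0 (h.F_tangent Y).1 (h.F_tangent Y).2
    rw [h1, h2, Submodule.mem_span_pair]
    refine ⟨a * c - b * d, a * d + b * c, ?_⟩
    simp only [map_add, map_smul, _root_.add_apply, _root_.smul_apply,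
      h.B_J, hvt, map_neg]
    module
  · push Not at hF
    refine ⟨0, 0, fun X Y => ?_⟩
    rw [h.decomp X Y, hB _ _ (h.idem X), h.B_symm _ (Q Y), hB _ _ (h.idem Y),
      hF _ (h.F_tangent X).1 (h.F_tangent X).2]
    simp

/-- Where `II` does not take its values in a 2-dimensional space, `∇J` vanishes on `E`, even if `J`
is not assumed to be parallel. Otherwise there are `X ∈ F` and `e ∈ E` with
`v = (∇_X J) e ≠ 0`, and `II(e, J v) = 0`; put `k = (∇_{JX} J) e - J v`, so that `II(X, k) = 0`. If
`k = 0`, then also `II(e, v) = 0` and `E` is in the kernel of `II`. If `k ≠ 0`, then `II(e, v)` and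
`II(X, J k)` span the values of `II`. -/
theorem nablaJ_eq_zero (h : RuledJet J Q J' Q' B C)
    (h3 : ∀ n₁ n₂ : W, ∃ X Y, B X Y ∉ Submodule.span ℝ {n₁, n₂}) {X e : W} (hX : J (J X) = -X)
    (he : Q e = e) : nablaJ J J' X e = 0 := by
  -- only the component of `X` orthogonal to `E` matters
  wlog hQX : Q X = 0 generalizing X
  · have h4 : nablaJ J J' X e = nablaJ J J' (Q X) e + nablaJ J J' (X - Q X) e := by
      simp only [nablaJ, map_sub, _root_.sub_apply]; abel
    rw [h4, h.nablaJ_ruling (h.idem X) he, zero_add]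
    refine this ?_ ?_
    · rw [map_sub, map_sub, hX, h.tangent]; abel
    · rw [map_sub, h.idem, sub_self]
  by_contra hne
  have he0 : e ≠ 0 := by rintro rfl; exact hne (by simp [nablaJ])
  set v := nablaJ J J' X e with hv
  have hQv : Q v = 0 := h.Q_nablaJ X he
  have hvt : J (J v) = -v := h.tangent_nablaJ X e
  have hb : B e (J v) = 0 := h.B_ruling X hX he
  have hQJX : Q (J X) = 0 := by rw [h.comm, hQX, map_zero]
  set k := nablaJ J J' (J X) e - J v with hk
  have hQk : Q k = 0 := by
    rw [hk, map_sub, h.Q_nablaJ _ he, h.comm, hQv, map_zero, sub_zero]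
  have hkt : J (J k) = -k := by
    rw [hk, map_sub, map_sub, h.tangent_nablaJ, h.cube]; abel
  have hXk : B X k = 0 := by
    rw [hk, map_sub, h.B_nablaJ_comm hX (h.cube X) hQX hQJX he, h.B_J, sub_self]
  by_cases hk0 : k = 0
  · have h5 := h.B_ruling (J X) (h.cube X) he
    rw [sub_eq_zero.mp hk0, hvt, map_neg, neg_eq_zero] at h5
    obtain ⟨n₁, n₂, hn⟩ := h.B_mem_of_B_E_eq_zero
      (fun e' Z he' => h.B_E_eq_zero he he0 hQv hvt hne h5 hb he' Z)
    obtain ⟨X', Y', h'⟩ := h3 n₁ n₂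
    exact h' (hn X' Y')
  · have hX0 : X ≠ 0 := by
      rintro hX0
      apply hne
      rw [hv, hX0]; simp [nablaJ]
    have hE : ∀ e' Z, Q e' = e' → Q Z = 0 → J (J Z) = -Z →
        ∃ t : ℝ, B e' Z = t • B e v := by
      intro e' Z he' hZ hZt
      obtain ⟨a, b, rfl⟩ := h.span_E e e' he he0 he'
      obtain ⟨c, d, rfl⟩ := h.span_F v Z hQv hvt hne hZ hZt
      refine ⟨a * c - b * d, ?_⟩
      simp only [map_add, map_smul, _root_.add_apply, _root_.smul_apply,
        h.B_J, hvt, map_neg, hb]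
      module
    obtain ⟨X', Y', h'⟩ := h3 (B e v) (B X (J k))
    apply h'
    obtain ⟨t₁, ht₁⟩ := hE (Q X') _ (h.idem _) (h.F_tangent Y').1 (h.F_tangent Y').2
    obtain ⟨t₂, ht₂⟩ := hE (Q Y') _ (h.idem _) (h.F_tangent X').1 (h.F_tangent X').2
    obtain ⟨a, b, h1⟩ := h.span_F X _ hQX hX hX0 (h.F_tangent X').1 (h.F_tangent X').2
    obtain ⟨c, d, h2⟩ := h.span_F k _ hQk hkt hk0 (h.F_tangent Y').1 (h.F_tangent Y').2
    have e1 : B (Q X') (-J (J Y')) = B (Q X') (-J (J Y') - Q Y') := by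
      rw [map_sub, h.B_E _ _ (h.idem X') (h.idem Y'), sub_zero]
    rw [h.decomp X' Y', e1, ht₁, h.B_symm _ (Q Y'), ht₂, h1, h2, Submodule.mem_span_pair]
    refine ⟨t₁ + t₂, a * d + b * c, ?_⟩
    simp only [map_add, map_smul, _root_.add_apply, _root_.smul_apply,
      h.B_J, hkt, map_neg, hXk]
    module

theorem defect_eq_zero_of_span (h : RuledJet J Q J' Q' B C)
    (h3 : ∀ n₁ n₂ : W, ∃ X Y, B X Y ∉ Submodule.span ℝ {n₁, n₂}) {Y e : W} (hY : J (J Y) = -Y)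
    (he : Q e = e) : defect J Q' Y e = 0 := by
  by_contra hne
  obtain ⟨n₁, n₂, hn⟩ := h.B_mem_of_B_E_eq_zero fun e' Z he' =>
    h.B_E_eq_zero_of_defect_ne_zero (fun X e hX he => h.nablaJ_eq_zero h3 hX he) hY he hne he' Z
  obtain ⟨X', Y', h'⟩ := h3 n₁ n₂
  exact h' (hn X' Y')

/-- Suppose that `E` lies in the kernel of `II` and, as expressed by `hC`, stays there to first
order. Then a non-zero obstruction, which generates `F`, is in the kernel of `II` too. -/
theorem B_eq_zero_of_defect_ne_zero (h : RuledJet J Q J' Q' B C)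
    (hA : ∀ X e, J (J X) = -X → Q e = e → nablaJ J J' X e = 0)
    (hE : ∀ e Z, Q e = e → B e Z = 0)
    (hC : ∀ Y Z e, Q e = e → C Y Z e = -B Z (Q' Y e))
    {Y e : W} (hY : J (J Y) = -Y) (he : Q e = e) (hne : defect J Q' Y e ≠ 0) (X Z : W) :
    B X Z = 0 := by
  have hs : ∀ X Y e, J (J X) = -X → J (J Y) = -Y → Q e = e → B X (Q' Y e) = B Y (Q' X e) := by
    intro X Y e hX hY he
    have := h.codazzi X Y e hX hY (h.tangent_of_mem he)
    rw [hC _ _ _ he, hC _ _ _ he, neg_inj] at this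
    exact this.symm
  have hJ : ∀ X Y e, J (J Y) = -Y → Q e = e → B X (Q' Y (J e)) = B X (J (Q' Y e)) := by
    intro X Y e hY he
    rw [h.Q'_J Y he, map_add, ← h.B_nablaJ, hA Y e hY he, map_zero, zero_add]
  have hD : ∀ X, J (J X) = -X → B X (defect J Q' Y e) = 0 := by
    intro X hX
    rw [defect, map_sub, hs X (J Y) e hX (h.cube Y) he, h.B_J, ← hJ Y X e hX he,
      hs Y X _ hY hX (h.J_mem he), sub_self]
  have hDJ : ∀ X, J (J X) = -X → B X (J (defect J Q' Y e)) = 0 := by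
    intro X hX
    rw [← h.B_J, hD _ (h.cube X)]
  obtain ⟨a, b, h1⟩ := h.span_F _ _ (h.Q_defect Y he) (h.tangent_defect Y he) hne
    (h.F_tangent Z).1 (h.F_tangent Z).2
  rw [h.decomp, hE _ _ (h.idem X), h.B_symm _ (Q Z), hE _ _ (h.idem Z), h1, map_add, map_smul,
    map_smul, hD _ (h.F_tangent X).2, hDJ _ (h.F_tangent X).2]
  simp

end RuledJet
end Jet

/-! ### The structure equations in a chart -/

section Chart
open Filter Topology

variable {V W : Type*} [NormedAddCommGroup V] [NormedSpace ℝ V]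
  [NormedAddCommGroup W] [InnerProductSpace ℝ W]

/-- The operator `-J²`; for an orthogonal almost complex structure extended by zero to the normal
space this is the orthogonal projection onto the tangent space. -/
def tangentProj {X : Type*} (J : X → W →L[ℝ] W) (x : X) : W →L[ℝ] W := -(J x ∘L J x)

theorem tangentProj_apply {X : Type*} (J : X → W →L[ℝ] W) (x : X) (Z : W) :
    tangentProj J x Z = -J x (J x Z) := rfl

/-- The second fundamental form as a bilinear map on the ambient space, `II(Y, Z) = (D_Y Π) Π Z`,
where `Π` is the projection to the tangent space, and `G` takes an ambient vector to the
coordinates of its tangent part. -/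
def bform (G : V → W →L[ℝ] V) (J : V → W →L[ℝ] W) (x : V) : W →L[ℝ] W →L[ℝ] W :=
  ((ContinuousLinearMap.compL ℝ W W W).flip (tangentProj J x)) ∘L
    (fderiv ℝ (tangentProj J) x ∘L G x)

theorem bform_apply (G : V → W →L[ℝ] V) (J : V → W →L[ℝ] W) (x : V) (Y Z : W) :
    bform G J x Y Z = fderiv ℝ (tangentProj J) x (G x Y) (tangentProj J x Z) := rfl

/-- The coordinate expression over `Ω` of a 2-ruled submanifold of Type A: `φ` is the immersion,
`G x` the left inverse of its differential that vanishes on normal vectors, `J` the almost complex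
structure and `Q` the projection to the planes of the ruling. -/
structure RuledChart (Ω : Set V) (φ : V → W) (G : V → W →L[ℝ] V) (J Q : V → W →L[ℝ] W) :
    Prop where
  isOpen : IsOpen Ω
  smooth_φ : ContDiffOn ℝ ∞ φ Ω
  smooth_G : ContDiffOn ℝ ∞ G Ω
  smooth_J : ContDiffOn ℝ ∞ J Ω
  smooth_Q : ContDiffOn ℝ ∞ Q Ω
  G_fderiv : ∀ x ∈ Ω, ∀ u, G x (fderiv ℝ φ x u) = u
  G_proj : ∀ x ∈ Ω, ∀ Y, G x (tangentProj J x Y) = G x Y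
  J_skew : ∀ x ∈ Ω, ∀ Y Z, ⟪J x Y, Z⟫ = -⟪Y, J x Z⟫
  J_range : ∀ x ∈ Ω, ∀ Y, ∃ u, J x Y = fderiv ℝ φ x u
  J_sq : ∀ x ∈ Ω, ∀ u, J x (J x (fderiv ℝ φ x u)) = -fderiv ℝ φ x u
  Q_symm : ∀ x ∈ Ω, ∀ Y Z, ⟪Q x Y, Z⟫ = ⟪Y, Q x Z⟫
  Q_idem : ∀ x ∈ Ω, ∀ Y, Q x (Q x Y) = Q x Y
  Q_range : ∀ x ∈ Ω, ∀ Y, ∃ u, Q x Y = fderiv ℝ φ x u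
  comm : ∀ x ∈ Ω, ∀ Y, Q x (J x Y) = J x (Q x Y)
  span_E : ∀ x ∈ Ω, ∀ e Z, Q x e = e → e ≠ 0 → Q x Z = Z → ∃ a b : ℝ, Z = a • e + b • J x e
  span_F : ∀ x ∈ Ω, ∀ v Z, Q x v = 0 → J x (J x v) = -v → v ≠ 0 → Q x Z = 0 →
    J x (J x Z) = -Z → ∃ a b : ℝ, Z = a • v + b • J x v
  ruled : ∀ x ∈ Ω, ∀ u, Q x (fderiv ℝ φ x u) = fderiv ℝ φ x u → fderiv ℝ Q x u = 0
  typeA : ∀ x ∈ Ω, ∀ u v, fderiv ℝ (tangentProj J) x u (J x (fderiv ℝ φ x v)) =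
    fderiv ℝ (tangentProj J) x v (J x (fderiv ℝ φ x u))

/-- A linear relation satisfied by a function is satisfied by its derivatives. -/
theorem clm_fderiv_eq {F F' : Type*} [NormedAddCommGroup F] [NormedSpace ℝ F]
    [NormedAddCommGroup F'] [NormedSpace ℝ F'] {T : V → F} {x : V} (hT : DifferentiableAt ℝ T x)
    (L L' : F →L[ℝ] F') (h : ∀ᶠ y in 𝓝 x, L (T y) = L' (T y)) (u : V) :
    L (fderiv ℝ T x u) = L' (fderiv ℝ T x u) := by
  have h1 := (L.hasFDerivAt.comp x hT.hasFDerivAt)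
  have h2 := (L'.hasFDerivAt.comp x hT.hasFDerivAt)
  exact DFunLike.congr_fun (h1.unique (h2.congr_of_eventuallyEq h)) u

theorem fderiv_fderiv_comm {F : Type*} [NormedAddCommGroup F] [NormedSpace ℝ F] {T : V → F} {x : V}
    (hT : ContDiffAt ℝ ∞ T x) (u v : V) :
    fderiv ℝ (fderiv ℝ T) x u v = fderiv ℝ (fderiv ℝ T) x v u := by
  have h2 : minSmoothness ℝ 2 ≤ ∞ := by
    simpa using WithTop.coe_le_coe.mpr (le_top (a := (2 : ℕ∞)))
  exact (hT.isSymmSndFDerivAt h2).eq u v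

/-- If `P` fixes the image of the differential of `φ`, then its derivative gives the part of the
second derivative of `φ` that `P` removes. -/
theorem fderiv_proj_add {P : V → W →L[ℝ] W} {φ : V → W} {x : V} {P' : V →L[ℝ] W →L[ℝ] W}
    {φ'' : V →L[ℝ] V →L[ℝ] W} (hP : HasFDerivAt P P' x) (hφ : HasFDerivAt (fderiv ℝ φ) φ'' x)
    (h : ∀ᶠ y in 𝓝 x, ∀ v, P y (fderiv ℝ φ y v) = fderiv ℝ φ y v) (u v : V) :
    P' u (fderiv ℝ φ x v) + P x (φ'' u v) = φ'' u v := by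
  have h1 := hP.clm_apply (hφ.clm_apply (hasFDerivAt_const v x))
  have h2 := hφ.clm_apply (hasFDerivAt_const v x)
  have h3 := DFunLike.congr_fun (h1.unique (h2.congr_of_eventuallyEq (h.mono fun y hy => hy v))) u
  simpa [add_comm] using h3

namespace RuledChart

variable {Ω : Set V} {φ : V → W} {G : V → W →L[ℝ] V} {J Q : V → W →L[ℝ] W} {x : V}

section
variable (h : RuledChart Ω φ G J Q) (hx : x ∈ Ω)
include h hx

theorem nhds : Ω ∈ 𝓝 x := h.isOpen.mem_nhds hx

theorem contDiffAt_φ : ContDiffAt ℝ ∞ φ x := h.smooth_φ.contDiffAt (h.nhds hx)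
theorem contDiffAt_G : ContDiffAt ℝ ∞ G x := h.smooth_G.contDiffAt (h.nhds hx)
theorem contDiffAt_J : ContDiffAt ℝ ∞ J x := h.smooth_J.contDiffAt (h.nhds hx)
theorem contDiffAt_Q : ContDiffAt ℝ ∞ Q x := h.smooth_Q.contDiffAt (h.nhds hx)

theorem contDiffAt_tangentProj : ContDiffAt ℝ ∞ (tangentProj J) x :=
  ((h.contDiffAt_J hx).clm_comp (h.contDiffAt_J hx)).neg

theorem contDiffAt_fderiv_tangentProj : ContDiffAt ℝ ∞ (fderiv ℝ (tangentProj J)) x :=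
  (h.contDiffAt_tangentProj hx).fderiv_right (m := ∞) (by simp)

theorem contDiffAt_bform : ContDiffAt ℝ ∞ (bform G J) x := by
  unfold bform
  exact (((ContinuousLinearMap.compL ℝ W W W).flip.contDiff.contDiffAt).comp x
    (h.contDiffAt_tangentProj hx)).clm_comp
    ((h.contDiffAt_fderiv_tangentProj hx).clm_comp (h.contDiffAt_G hx))

theorem hasFDerivAt_J : HasFDerivAt J (fderiv ℝ J x) x :=
  ((h.contDiffAt_J hx).differentiableAt (by simp)).hasFDerivAt
theorem hasFDerivAt_Q : HasFDerivAt Q (fderiv ℝ Q x) x :=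
  ((h.contDiffAt_Q hx).differentiableAt (by simp)).hasFDerivAt
theorem hasFDerivAt_G : HasFDerivAt G (fderiv ℝ G x) x :=
  ((h.contDiffAt_G hx).differentiableAt (by simp)).hasFDerivAt
theorem hasFDerivAt_tangentProj :
    HasFDerivAt (tangentProj J) (fderiv ℝ (tangentProj J) x) x :=
  ((h.contDiffAt_tangentProj hx).differentiableAt (by simp)).hasFDerivAt
theorem hasFDerivAt_bform : HasFDerivAt (bform G J) (fderiv ℝ (bform G J) x) x :=
  ((h.contDiffAt_bform hx).differentiableAt (by simp)).hasFDerivAt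

theorem cube (Y : W) : J x (J x (J x Y)) = -J x Y := by
  obtain ⟨u, hu⟩ := h.J_range x hx Y
  rw [hu, h.J_sq x hx]

theorem proj_range (Y : W) : ∃ u, tangentProj J x Y = fderiv ℝ φ x u := by
  obtain ⟨u, hu⟩ := h.J_range x hx (J x Y)
  exact ⟨-u, by rw [map_neg, ← hu]; rfl⟩

theorem proj_fderiv (u : V) : tangentProj J x (fderiv ℝ φ x u) = fderiv ℝ φ x u := by
  rw [tangentProj_apply, h.J_sq x hx, neg_neg]

theorem proj_proj (Y : W) : tangentProj J x (tangentProj J x Y) = tangentProj J x Y := by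
  obtain ⟨u, hu⟩ := h.proj_range hx Y
  rw [hu, h.proj_fderiv hx]

theorem proj_Q (Y : W) : tangentProj J x (Q x Y) = Q x Y := by
  obtain ⟨u, hu⟩ := h.Q_range x hx Y
  rw [hu, h.proj_fderiv hx]

theorem J_proj (Y : W) : J x (tangentProj J x Y) = J x Y := by
  rw [tangentProj_apply, map_neg, h.cube hx, neg_neg]

theorem proj_J (Y : W) : tangentProj J x (J x Y) = J x Y := by
  rw [tangentProj_apply, h.cube hx, neg_neg]

theorem fderiv_G {Y : W} (hY : tangentProj J x Y = Y) : fderiv ℝ φ x (G x Y) = Y := by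
  obtain ⟨u, hu⟩ := h.proj_range hx Y
  rw [← hY, hu, h.G_fderiv x hx]

/-- The derivative of `Π² = Π`. -/
theorem proj_deriv (u : V) (Y : W) : fderiv ℝ (tangentProj J) x u (tangentProj J x Y) +
    tangentProj J x (fderiv ℝ (tangentProj J) x u Y) = fderiv ℝ (tangentProj J) x u Y := by
  have h1 := (h.hasFDerivAt_tangentProj hx).clm_apply
    ((h.hasFDerivAt_tangentProj hx).clm_apply (hasFDerivAt_const Y x))
  have h2 := (h.hasFDerivAt_tangentProj hx).clm_apply (hasFDerivAt_const Y x)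
  have h3 := DFunLike.congr_fun (h1.unique (h2.congr_of_eventuallyEq
    (eventually_of_mem (h.nhds hx) fun y hy => h.proj_proj hy Y))) u
  simpa [add_comm] using h3

theorem proj_deriv_proj (u : V) {Y : W} (hY : tangentProj J x Y = Y) :
    tangentProj J x (fderiv ℝ (tangentProj J) x u Y) = 0 := by
  have := h.proj_deriv hx u Y
  rw [hY] at this
  exact add_eq_left.mp this

/-- The derivative of `Π Q = Q`. -/
theorem proj_Q_deriv (u : V) (Y : W) : fderiv ℝ (tangentProj J) x u (Q x Y) +
    tangentProj J x (fderiv ℝ Q x u Y) = fderiv ℝ Q x u Y := by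
  have h1 := (h.hasFDerivAt_tangentProj hx).clm_apply
    ((h.hasFDerivAt_Q hx).clm_apply (hasFDerivAt_const Y x))
  have h2 := (h.hasFDerivAt_Q hx).clm_apply (hasFDerivAt_const Y x)
  have h3 := DFunLike.congr_fun (h1.unique (h2.congr_of_eventuallyEq
    (eventually_of_mem (h.nhds hx) fun y hy => h.proj_Q hy Y))) u
  simpa [add_comm] using h3

theorem isSymm_φ (u v : V) :
    fderiv ℝ (fderiv ℝ φ) x u v = fderiv ℝ (fderiv ℝ φ) x v u :=
  fderiv_fderiv_comm (h.contDiffAt_φ hx) u v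

theorem isSymm_tangentProj (u v : V) :
    fderiv ℝ (fderiv ℝ (tangentProj J)) x u v = fderiv ℝ (fderiv ℝ (tangentProj J)) x v u :=
  fderiv_fderiv_comm (h.contDiffAt_tangentProj hx) u v

theorem hasFDerivAt_fderiv_φ : HasFDerivAt (fderiv ℝ φ) (fderiv ℝ (fderiv ℝ φ) x) x :=
  (((h.contDiffAt_φ hx).fderiv_right (m := ∞) (by simp)).differentiableAt (by simp)).hasFDerivAt

theorem hasFDerivAt_fderiv_tangentProj : HasFDerivAt (fderiv ℝ (tangentProj J))
    (fderiv ℝ (fderiv ℝ (tangentProj J)) x) x :=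
  ((h.contDiffAt_fderiv_tangentProj hx).differentiableAt (by simp)).hasFDerivAt

theorem fderiv_proj_symm (u v : V) : fderiv ℝ (tangentProj J) x u (fderiv ℝ φ x v) =
    fderiv ℝ (tangentProj J) x v (fderiv ℝ φ x u) := by
  have key := fderiv_proj_add (h.hasFDerivAt_tangentProj hx) (h.hasFDerivAt_fderiv_φ hx)
    (eventually_of_mem (h.nhds hx) fun y hy => h.proj_fderiv hy)
  have h1 := key u v
  rw [h.isSymm_φ hx u v] at h1
  exact add_right_cancel (h1.trans (key v u).symm)

theorem bform_eq {Y Z : W} {u v : V} (hu : tangentProj J x Y = fderiv ℝ φ x u)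
    (hv : tangentProj J x Z = fderiv ℝ φ x v) :
    bform G J x Y Z = fderiv ℝ (tangentProj J) x u (fderiv ℝ φ x v) := by
  rw [bform_apply, hv, ← h.G_proj x hx, hu, h.G_fderiv x hx]

theorem bform_symm (Y Z : W) : bform G J x Y Z = bform G J x Z Y := by
  obtain ⟨u, hu⟩ := h.proj_range hx Y
  obtain ⟨v, hv⟩ := h.proj_range hx Z
  rw [h.bform_eq hx hu hv, h.bform_eq hx hv hu, h.fderiv_proj_symm hx]

theorem bform_J (Y Z : W) : bform G J x (J x Y) Z = bform G J x Y (J x Z) := by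
  obtain ⟨u, hu⟩ := h.proj_range hx Y
  obtain ⟨v, hv⟩ := h.proj_range hx Z
  have hJ : ∀ {Y u}, tangentProj J x Y = fderiv ℝ φ x u →
      J x Y = J x (fderiv ℝ φ x u) := fun hu => by rw [← hu, h.J_proj hx]
  obtain ⟨u', hu'⟩ := h.J_range x hx Y
  obtain ⟨v', hv'⟩ := h.J_range x hx Z
  rw [h.bform_eq hx (u := u') (by rw [h.proj_J hx, hu']) hv,
    h.bform_eq hx (v := v') hu (by rw [h.proj_J hx, hv']), h.fderiv_proj_symm hx, ← hu', ← hv',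
    hJ hu, hJ hv, h.typeA x hx]

theorem proj_bform (Y Z : W) : J x (J x (bform G J x Y Z)) = 0 := by
  rw [← neg_eq_zero]
  exact h.proj_deriv_proj hx _ (h.proj_proj hx Z)

theorem bform_E {Y : W} (hY : Q x Y = Y) {Z : W} (hZ : Q x Z = Z) : bform G J x Y Z = 0 := by
  have hp : tangentProj J x Y = Y := by rw [← hY, h.proj_Q hx]
  have h1 := h.proj_Q_deriv hx (G x Y) Z
  rw [h.ruled x hx (G x Y) (by rw [h.fderiv_G hx hp, hY])] at h1
  rw [bform_apply, ← hZ, h.proj_Q hx]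
  simpa using h1

theorem bform_deriv_E (Y Z Z' : W) (hZ : Q x Z = Z) (hZ' : Q x Z' = Z') :
    fderiv ℝ (bform G J) x (G x Y) Z Z' + bform G J x (fderiv ℝ Q x (G x Y) Z) Z' +
      bform G J x Z (fderiv ℝ Q x (G x Y) Z') = 0 := by
  have h1 := ((h.hasFDerivAt_bform hx).clm_apply ((h.hasFDerivAt_Q hx).clm_apply
    (hasFDerivAt_const Z x))).clm_apply ((h.hasFDerivAt_Q hx).clm_apply (hasFDerivAt_const Z' x))
  have h3 := DFunLike.congr_fun (h1.unique ((hasFDerivAt_const (0 : W) x).congr_of_eventuallyEq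
    (eventually_of_mem (h.nhds hx) fun y hy =>
      h.bform_E hy (h.Q_idem y hy Z) (h.Q_idem y hy Z')))) (G x Y)
  simp [hZ, hZ'] at h3
  rw [← h3]; abel

theorem bform_deriv_J (Y Z Z' : W) :
    fderiv ℝ (bform G J) x (G x Y) (J x Z) Z' + bform G J x (fderiv ℝ J x (G x Y) Z) Z' =
      fderiv ℝ (bform G J) x (G x Y) Z (J x Z') +
        bform G J x Z (fderiv ℝ J x (G x Y) Z') := by
  have h1 := ((h.hasFDerivAt_bform hx).clm_apply ((h.hasFDerivAt_J hx).clm_apply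
    (hasFDerivAt_const Z x))).clm_apply (hasFDerivAt_const Z' x)
  have h2 := ((h.hasFDerivAt_bform hx).clm_apply (hasFDerivAt_const Z x)).clm_apply
    ((h.hasFDerivAt_J hx).clm_apply (hasFDerivAt_const Z' x))
  have h3 := DFunLike.congr_fun (h1.unique (h2.congr_of_eventuallyEq
    (eventually_of_mem (h.nhds hx) fun y hy => h.bform_J hy Z Z'))) (G x Y)
  simp at h3
  rw [add_comm, h3, add_comm]

/-- The Codazzi equation, as a consequence of the symmetry of the second derivative of the tangent
projection `Π`: the normal part of the derivative of `II` is totally symmetric. -/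
theorem codazzi {Y Z Z' : W} (hY : tangentProj J x Y = Y) (hZ : tangentProj J x Z = Z)
    (hZ' : tangentProj J x Z' = Z') :
    fderiv ℝ (bform G J) x (G x Y) Z Z' -
        tangentProj J x (fderiv ℝ (bform G J) x (G x Y) Z Z') =
      fderiv ℝ (bform G J) x (G x Z) Y Z' -
        tangentProj J x (fderiv ℝ (bform G J) x (G x Z) Y Z') := by
  set P := tangentProj J with hP
  -- the derivative of `G` on tangent vectors
  have hG : ∀ u v, fderiv ℝ G x u (fderiv ℝ φ x v) = -G x (fderiv ℝ (fderiv ℝ φ) x u v) := by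
    intro u v
    have h1 := (h.hasFDerivAt_G hx).clm_apply
      ((h.hasFDerivAt_fderiv_φ hx).clm_apply (hasFDerivAt_const v x))
    have h3 := DFunLike.congr_fun (h1.unique ((hasFDerivAt_const v x).congr_of_eventuallyEq
      (eventually_of_mem (h.nhds hx) fun y hy => h.G_fderiv y hy v))) u
    simp at h3
    exact eq_neg_of_add_eq_zero_right h3
  have key : ∀ u v, fderiv ℝ (bform G J) x u (fderiv ℝ φ x v) Z' -
      P x (fderiv ℝ (bform G J) x u (fderiv ℝ φ x v) Z') =
      (fderiv ℝ (fderiv ℝ P) x u v Z' -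
        fderiv ℝ P x (G x (fderiv ℝ (fderiv ℝ φ) x u v)) Z') -
      P x (fderiv ℝ (fderiv ℝ P) x u v Z' -
        fderiv ℝ P x (G x (fderiv ℝ (fderiv ℝ φ) x u v)) Z') := by
    intro u v
    have h1 := ((h.hasFDerivAt_bform hx).clm_apply
      (hasFDerivAt_const (fderiv ℝ φ x v) x)).clm_apply (hasFDerivAt_const Z' x)
    have h2 := ((h.hasFDerivAt_fderiv_tangentProj hx).clm_apply ((h.hasFDerivAt_G hx).clm_apply
      (hasFDerivAt_const (fderiv ℝ φ x v) x))).clm_apply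
      ((h.hasFDerivAt_tangentProj hx).clm_apply (hasFDerivAt_const Z' x))
    have h3 := DFunLike.congr_fun (h1.unique h2) u
    simp only [add_apply, ContinuousLinearMap.comp_apply, ContinuousLinearMap.flip_apply, zero_add,
      ContinuousLinearMap.comp_zero, h.G_fderiv x hx, hG, hZ',
      ← hP, map_neg, neg_apply] at h3
    have h4 : fderiv ℝ P x v (fderiv ℝ P x u Z') -
        P x (fderiv ℝ P x v (fderiv ℝ P x u Z')) = 0 := by
      have := h.proj_deriv hx v (fderiv ℝ P x u Z')
      rw [h.proj_deriv_proj hx u hZ', map_zero, zero_add] at this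
      rw [this, sub_self]
    rw [h3]
    simp only [map_add, map_sub, map_neg]
    rw [← sub_eq_zero, ← h4]
    abel
  have k1 := key (G x Y) (G x Z)
  have k2 := key (G x Z) (G x Y)
  rw [h.fderiv_G hx hZ] at k1
  rw [h.fderiv_G hx hY] at k2
  rw [k1, k2, h.isSymm_φ hx, h.isSymm_tangentProj hx]

theorem jet : RuledJet (J x) (Q x) (fderiv ℝ J x ∘L G x) (fderiv ℝ Q x ∘L G x) (bform G J x)
    (fun Y Z Z' => fderiv ℝ (bform G J) x (G x Y) Z Z' -
      tangentProj J x (fderiv ℝ (bform G J) x (G x Y) Z Z')) where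
  skew := h.J_skew x hx
  cube := h.cube hx
  symm := h.Q_symm x hx
  idem := h.Q_idem x hx
  comm := h.comm x hx
  tangent Y := by rw [← neg_eq_iff_eq_neg]; exact h.proj_Q hx Y
  span_E := h.span_E x hx
  span_F := h.span_F x hx
  skew' Y Z Z' := by
    have h1 := ((h.hasFDerivAt_J hx).clm_apply (hasFDerivAt_const Z x)).inner ℝ
      (hasFDerivAt_const Z' x)
    have h2 := ((hasFDerivAt_const Z x).inner ℝ
      ((h.hasFDerivAt_J hx).clm_apply (hasFDerivAt_const Z' x))).neg
    have h3 := DFunLike.congr_fun (h1.unique (h2.congr_of_eventuallyEq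
      (eventually_of_mem (h.nhds hx) fun y hy => h.J_skew y hy Z Z'))) (G x Y)
    simpa using h3
  anti' Y Z hZ := by
    have h1 := (h.hasFDerivAt_J hx).clm_apply ((h.hasFDerivAt_J hx).clm_apply
      ((h.hasFDerivAt_J hx).clm_apply (hasFDerivAt_const (J x Z) x)))
    have h2 := ((h.hasFDerivAt_J hx).clm_apply (hasFDerivAt_const (J x Z) x)).neg
    have h3 := DFunLike.congr_fun (h1.unique (h2.congr_of_eventuallyEq
      (eventually_of_mem (h.nhds hx) fun y hy => h.cube hy (J x Z)))) (G x Y)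
    simp [hZ] at h3
    simp only [ContinuousLinearMap.comp_apply]
    exact add_neg_eq_zero.mp h3
  comm' Y Z := by
    have h1 := (h.hasFDerivAt_Q hx).clm_apply ((h.hasFDerivAt_J hx).clm_apply
      (hasFDerivAt_const Z x))
    have h2 := (h.hasFDerivAt_J hx).clm_apply ((h.hasFDerivAt_Q hx).clm_apply
      (hasFDerivAt_const Z x))
    have h3 := DFunLike.congr_fun (h1.unique (h2.congr_of_eventuallyEq
      (eventually_of_mem (h.nhds hx) fun y hy => h.comm y hy Z))) (G x Y)
    simp at h3
    simp only [ContinuousLinearMap.comp_apply]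
    rw [add_comm, h3, add_comm]
  idem' Y Z hZ := by
    have h1 := (h.hasFDerivAt_Q hx).clm_apply ((h.hasFDerivAt_Q hx).clm_apply
      (hasFDerivAt_const Z x))
    have h2 := (h.hasFDerivAt_Q hx).clm_apply (hasFDerivAt_const Z x)
    have h3 := DFunLike.congr_fun (h1.unique (h2.congr_of_eventuallyEq
      (eventually_of_mem (h.nhds hx) fun y hy => h.Q_idem y hy Z))) (G x Y)
    simpa [hZ] using h3
  ruled Y hY := by
    have hp : tangentProj J x Y = Y := by rw [← hY, h.proj_Q hx]
    exact h.ruled x hx (G x Y) (by rw [h.fderiv_G hx hp, hY])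
  B_symm := h.bform_symm hx
  B_J := h.bform_J hx
  B_proj Y Z := by
    rw [bform_apply, bform_apply, ← h.G_proj x hx Y, tangentProj_apply J x Y]
    simp
  B_E Y Z hY hZ := h.bform_E hx hY hZ
  normal' Y Z hZ := by
    have h1 := h.proj_Q_deriv hx (G x Y) Z
    have h2 := h.proj_Q hx Z
    rw [hZ] at h1 h2
    rw [bform_apply, h2, eq_sub_of_add_eq h1, tangentProj_apply, sub_neg_eq_add]
    rfl
  C_symm Y Z Z' := by
    have := clm_fderiv_eq ((h.contDiffAt_bform hx).differentiableAt (by simp))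
      (ContinuousLinearMap.apply ℝ W Z' ∘L ContinuousLinearMap.apply ℝ (W →L[ℝ] W) Z)
      (ContinuousLinearMap.apply ℝ W Z ∘L ContinuousLinearMap.apply ℝ (W →L[ℝ] W) Z')
      (eventually_of_mem (h.nhds hx) fun y hy => h.bform_symm hy Z Z') (G x Y)
    simp only [ContinuousLinearMap.comp_apply, ContinuousLinearMap.apply_apply] at this
    rw [this]
  codazzi Y Z Z' hY hZ hZ' := h.codazzi hx (by rw [tangentProj_apply, hY, neg_neg])
    (by rw [tangentProj_apply, hZ, neg_neg]) (by rw [tangentProj_apply, hZ', neg_neg])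
  C_E Y Z Z' hZ hZ' := by
    have h1 := h.bform_deriv_E hx Y Z Z' hZ hZ'
    rw [add_assoc] at h1
    rw [eq_neg_of_add_eq_zero_left h1]
    simp only [tangentProj_apply, map_neg, map_add, h.proj_bform hx,
      ContinuousLinearMap.comp_apply]
    abel
  C_J Y Z Z' := by
    have h1 := h.bform_deriv_J hx Y Z Z'
    have h2 := congrArg (fun T => J x (J x T)) h1
    simp only [map_add, h.proj_bform hx, add_zero] at h2
    simp only [tangentProj_apply, h2, ContinuousLinearMap.comp_apply]
    rw [sub_add_eq_add_sub, h1, sub_add_eq_add_sub]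

end

/-- The obstruction is continuous, so it remains non-zero near a point where it is non-zero. -/
theorem eventually_defect_ne_zero (h : RuledChart Ω φ G J Q) (hx : x ∈ Ω) {Y e : W}
    (hY : J x (J x Y) = -Y) (he : Q x e = e)
    (hne : RuledJet.defect (J x) (fderiv ℝ Q x ∘L G x) Y e ≠ 0) :
    ∀ᶠ y in 𝓝 x, y ∈ Ω ∧ ∃ Y e, J y (J y Y) = -Y ∧ Q y e = e ∧
      RuledJet.defect (J y) (fderiv ℝ Q y ∘L G y) Y e ≠ 0 := by
  have cJ := (h.contDiffAt_J hx).continuousAt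
  have cG := (h.contDiffAt_G hx).continuousAt
  have cQ := (h.contDiffAt_Q hx).continuousAt
  have cQ' := ((h.contDiffAt_Q hx).fderiv_right (m := ∞) (by simp)).continuousAt
  have hc : ContinuousAt (fun y => RuledJet.defect (J y) (fderiv ℝ Q y ∘L G y)
      (tangentProj J y Y) (Q y e)) x := by
    simp only [RuledJet.defect, tangentProj_apply, ContinuousLinearMap.comp_apply]
    fun_prop
  have h0 : (fun y => RuledJet.defect (J y) (fderiv ℝ Q y ∘L G y)
      (tangentProj J y Y) (Q y e)) x ≠ 0 := by
    simpa only [tangentProj_apply, hY, neg_neg, he] using hne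
  filter_upwards [h.nhds hx, hc.eventually_ne h0] with y hy hyne
  refine ⟨hy, _, _, ?_, h.Q_idem y hy e, hyne⟩
  rw [tangentProj_apply, map_neg, map_neg, h.cube hy]

/-- The case of normal rank at least 3. -/
theorem defect_eq_zero_of_span (h : RuledChart Ω φ G J Q)
    (hd : ∀ x ∈ Ω, ∃ᶠ y in 𝓝 x, ∀ n₁ n₂ : W, ∃ X Y, bform G J y X Y ∉ Submodule.span ℝ {n₁, n₂})
    (hx : x ∈ Ω) {Y e : W} (hY : J x (J x Y) = -Y) (he : Q x e = e) :
    RuledJet.defect (J x) (fderiv ℝ Q x ∘L G x) Y e = 0 := by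
  by_contra hne
  obtain ⟨y, h3, hy, Y', e', hY', he', hne'⟩ :=
    ((hd x hx).and_eventually (h.eventually_defect_ne_zero hx hY he hne)).exists
  exact hne' ((h.jet hy).defect_eq_zero_of_span h3 hY' he')

/-- The Kähler case. -/
theorem defect_eq_zero_of_parallel (h : RuledChart Ω φ G J Q)
    (hd : ∀ x ∈ Ω, ∃ᶠ y in 𝓝 x, ∃ X Y, bform G J y X Y ≠ 0)
    (hA : ∀ x ∈ Ω, ∀ u v, tangentProj J x (fderiv ℝ J x u (fderiv ℝ φ x v)) = 0)
    (hx : x ∈ Ω) {Y e : W} (hY : J x (J x Y) = -Y) (he : Q x e = e) :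
    RuledJet.defect (J x) (fderiv ℝ Q x ∘L G x) Y e = 0 := by
  by_contra hne
  have hA' : ∀ y ∈ Ω, ∀ X e, J y (J y X) = -X → Q y e = e →
      RuledJet.nablaJ (J y) (fderiv ℝ J y ∘L G y) X e = 0 := by
    intro y hy X e hX he
    obtain ⟨v, hv⟩ := h.Q_range y hy e
    rw [he] at hv
    rw [RuledJet.nablaJ, hv]
    exact hA y hy _ v
  have hev := h.eventually_defect_ne_zero hx hY he hne
  have hB : ∀ᶠ y in 𝓝 x, ∀ Z Z', bform G J y Z (Q y Z') = 0 := by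
    filter_upwards [hev] with y ⟨hy, Y', e', hY', he', hne'⟩ Z Z'
    rw [h.bform_symm hy]
    exact (h.jet hy).B_E_eq_zero_of_defect_ne_zero (hA' y hy) hY' he' hne' (h.Q_idem y hy Z') Z
  obtain ⟨y, ⟨X, Z, hXZ⟩, ⟨hy, Y', e', hY', he', hne'⟩, hBy⟩ :=
    ((hd x hx).and_eventually (hev.and hB.eventually_nhds)).exists
  refine hXZ ((h.jet hy).B_eq_zero_of_defect_ne_zero (hA' y hy) ?_ ?_ hY' he' hne' X Z)
  · intro e Z he
    rw [h.bform_symm hy, ← he, hBy.self_of_nhds]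
  · intro Y Z e he
    have h1 := ((h.hasFDerivAt_bform hy).clm_apply (hasFDerivAt_const Z y)).clm_apply
      ((h.hasFDerivAt_Q hy).clm_apply (hasFDerivAt_const e y))
    have h3 := DFunLike.congr_fun (h1.unique ((hasFDerivAt_const (0 : W) y).congr_of_eventuallyEq
      (hBy.mono fun y' hy' => hy' Z e))) (G y Y)
    simp [he] at h3
    rw [eq_neg_of_add_eq_zero_right h3]
    simp only [tangentProj_apply, map_neg, h.proj_bform hy, ContinuousLinearMap.comp_apply]
    simp

end RuledChart
end Chart

/-! ### From the submanifold to its charts -/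

section Submanifold
open Filter Topology

variable {n : ℕ} {M : Type*} [TopologicalSpace M] [ChartedSpace (Euc 4) M]
variable {F F' : Type*} [NormedAddCommGroup F] [NormedSpace ℝ F] [NormedAddCommGroup F']
  [NormedSpace ℝ F']

/-- Tangent vectors at `p` are identified with their coordinates in the preferred chart at `p`, so
the differential at `p` is the derivative of the expression in this chart. -/
theorem D_eq_fderiv {h : M → F} {p : M} (hh : MDifferentiableAt 𝓘(ℝ, Euc 4) 𝓘(ℝ, F) h p) :
    D h p = fderiv ℝ (h ∘ (chartAt (Euc 4) p).symm) (chartAt (Euc 4) p p) := by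
  have key : ∀ L : Euc 4 →L[ℝ] F, HasFDerivWithinAt (h ∘ (chartAt (Euc 4) p).symm) L Set.univ
      (chartAt (Euc 4) p p) → L = fderiv ℝ (h ∘ (chartAt (Euc 4) p).symm) (chartAt (Euc 4) p p) :=
    fun L hL => (hasFDerivWithinAt_univ.mp hL).fderiv.symm
  have h2 := hh.hasMFDerivAt.2
  rw [modelWithCornersSelf_coe, Set.range_id] at h2
  exact key (D h p) h2

theorem D_clm_comp (L : F →L[ℝ] F') {h : M → F} {p : M}
    (hh : MDifferentiableAt 𝓘(ℝ, Euc 4) 𝓘(ℝ, F) h p) (X : TangentSpace 𝓘(ℝ, Euc 4) p) :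
    D (fun q => L (h q)) p X = L (D h p X) := by
  have h1 : MDifferentiableAt 𝓘(ℝ, F) 𝓘(ℝ, F') L (h p) := L.mdifferentiableAt
  have := mfderiv_comp_apply p h1 hh X
  rw [L.mfderiv_eq] at this
  exact this

section chart
variable [IsManifold 𝓘(ℝ, Euc 4) ∞ M]

theorem chart_symm_bijective (p : M) {x : Euc 4} (hx : x ∈ (chartAt (Euc 4) p).target) :
    Function.Bijective (mfderiv 𝓘(ℝ, Euc 4) 𝓘(ℝ, Euc 4) (chartAt (Euc 4) p).symm x) := by
  have h := mdifferentiable_chart (I := 𝓘(ℝ, Euc 4)) p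
  exact (h.symm.mfderiv (x := x) hx).bijective

theorem fderiv_comp_chart_symm (p : M) {x : Euc 4} (hx : x ∈ (chartAt (Euc 4) p).target)
    {h : M → F}
    (hh : MDifferentiableAt 𝓘(ℝ, Euc 4) 𝓘(ℝ, F) h ((chartAt (Euc 4) p).symm x)) (u : Euc 4) :
    fderiv ℝ (h ∘ (chartAt (Euc 4) p).symm) x u = D h ((chartAt (Euc 4) p).symm x)
      (mfderiv 𝓘(ℝ, Euc 4) 𝓘(ℝ, Euc 4) (chartAt (Euc 4) p).symm x u) := by
  have h1 := (mdifferentiable_chart (I := 𝓘(ℝ, Euc 4)) p).symm.mdifferentiableAt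
    (x := x) hx
  rw [← mfderiv_eq_fderiv]
  exact mfderiv_comp_apply x hh h1 u

theorem contDiffOn_comp_chart_symm (p : M) {h : M → F}
    (hh : ContMDiff 𝓘(ℝ, Euc 4) 𝓘(ℝ, F) ∞ h) :
    ContDiffOn ℝ ∞ (h ∘ (chartAt (Euc 4) p).symm) (chartAt (Euc 4) p).target := by
  rw [← contMDiffOn_iff_contDiffOn]
  exact hh.comp_contMDiffOn (contMDiffOn_chart_symm (I := 𝓘(ℝ, Euc 4)))

end chart

namespace IsOrthogonalComplexStructure

variable {f : M → Euc n} {J : M → Euc n →L[ℝ] Euc n} (hJ : IsOrthogonalComplexStructure f J)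
include hJ

theorem tangentProj_eq (p : M) : tangentProj J p = (tangentPlane f p).starProjection := by
  ext1 v
  have h1 : v = (tangentPlane f p).starProjection v +
      (v - (tangentPlane f p).starProjection v) := by abel
  have h2 := (tangentPlane f p).sub_starProjection_mem_orthogonal v
  rw [tangentProj_apply, h1, map_add, map_add, hJ.normal p _ h2, map_zero, add_zero,
    hJ.sq p _ ((tangentPlane f p).starProjection_apply_mem v), ← h1, neg_neg]

theorem J_tangentProj (p : M) (v : Euc n) : J p (tangentProj J p v) = J p v := by
  have h2 := (tangentPlane f p).sub_starProjection_mem_orthogonal v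
  have := hJ.normal p _ h2
  rw [map_sub, sub_eq_zero] at this
  rw [hJ.tangentProj_eq, this]

theorem J_mem (p : M) (v : Euc n) : J p v ∈ tangentPlane f p := by
  rw [← hJ.J_tangentProj, hJ.tangentProj_eq]
  exact hJ.tangent p _ ((tangentPlane f p).starProjection_apply_mem v)

theorem mem_iff (p : M) (v : Euc n) : v ∈ tangentPlane f p ↔ J p (J p v) = -v := by
  refine ⟨hJ.sq p v, fun h => ?_⟩
  rw [← neg_neg v, ← h]
  exact neg_mem (hJ.J_mem p _)

theorem skew (p : M) (v w : Euc n) : ⟪J p v, w⟫ = -⟪v, J p w⟫ := by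
  set T := tangentPlane f p
  have h0 : ∀ v ∈ T, ∀ w ∈ T, ⟪J p v, J p w⟫ = ⟪v, w⟫ := by
    intro v hv w hw
    rw [real_inner_eq_norm_add_mul_self_sub_norm_mul_self_sub_norm_mul_self_div_two,
      real_inner_eq_norm_add_mul_self_sub_norm_mul_self_sub_norm_mul_self_div_two,
      ← map_add, hJ.isometry p _ hv, hJ.isometry p _ hw, hJ.isometry p _ (T.add_mem hv hw)]
  have hP := hJ.tangentProj_eq p
  have h1 : ∀ v w, ⟪J p v, tangentProj J p w⟫ = ⟪J p v, w⟫ := fun v w => by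
    rw [hP, ← Submodule.inner_starProjection_left_eq_right,
      Submodule.starProjection_eq_self_iff.mpr (hJ.J_mem p v)]
  have hm : ∀ v, tangentProj J p v ∈ T := fun v => by
    rw [hP]; exact T.starProjection_apply_mem v
  rw [← h1, ← hJ.J_tangentProj p v, ← h0 _ (hJ.J_mem p _) _ (hm w), hJ.sq p _ (hm v),
    inner_neg_left, hJ.J_tangentProj, real_inner_comm, h1, real_inner_comm]

theorem contMDiff_tangentProj :
    ContMDiff 𝓘(ℝ, Euc 4) 𝓘(ℝ, Euc n →L[ℝ] Euc n) ∞ (tangentProj J) := by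
  have h : ContDiff ℝ ∞ (fun A : Euc n →L[ℝ] Euc n => -(A ∘L A)) :=
    (contDiff_id.clm_comp contDiff_id).neg
  exact h.contMDiff.comp hJ.smooth

end IsOrthogonalComplexStructure

variable {f : M → Euc n} {J : M → Euc n →L[ℝ] Euc n} {E : M → Submodule ℝ (Euc n)}

theorem secondFundForm_mem (f : M → Euc n) (p : M) (X Y : TangentSpace 𝓘(ℝ, Euc 4) p) :
    secondFundForm f p X Y ∈ (tangentPlane f p)ᗮ :=
  Submodule.starProjection_apply_mem _ _

theorem IsOrthonormalFrame.span_eq_top {p : M} {b : Fin 4 → TangentSpace 𝓘(ℝ, Euc 4) p}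
    (hb : IsOrthonormalFrame f p b) : Submodule.span ℝ (Set.range b) = ⊤ := by
  have h1 : LinearIndependent ℝ b :=
    LinearIndependent.of_comp (D f p).toLinearMap hb.linearIndependent
  apply h1.span_eq_top_of_card_eq_finrank
  have : Module.finrank ℝ (TangentSpace 𝓘(ℝ, Euc 4) p) = Module.finrank ℝ (Euc 4) := rfl
  rw [this]; simp

/-- The planes of the ruling are constant along the ruling. -/
theorem ruled_deriv (hf : IsSubmanifold f) (hE : IsTwoRuled f E) (p : M)
    (X : TangentSpace 𝓘(ℝ, Euc 4) p) (hX : D f p X ∈ E p) :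
    D (fun q => (E q).starProjection) p X = 0 := by
  obtain ⟨ε, hε, s, hs, hs0, h⟩ := hE.ruled p
  have hnh : Metric.ball (0 : E p) ε ∈ 𝓝 0 := Metric.ball_mem_nhds _ hε
  have hsd : MDifferentiableAt 𝓘(ℝ, E p) 𝓘(ℝ, Euc 4) s 0 :=
    (hs.contMDiffAt hnh).mdifferentiableAt (by simp)
  have hfd := (hf.1 p).mdifferentiableAt (by simp)
  have hQd := (hE.smooth p).mdifferentiableAt (by simp)
  set v : E p := ⟨D f p X, hX⟩ with hv
  set S : TangentSpace 𝓘(ℝ, Euc 4) p := mfderiv 𝓘(ℝ, E p) 𝓘(ℝ, Euc 4) s 0 v with hS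
  have h1 : mfderiv 𝓘(ℝ, E p) 𝓘(ℝ, Euc n) (f ∘ s) 0 v = D f p S :=
    mfderiv_comp_apply_of_eq 0 hfd hsd hs0 v
  have h2 : mfderiv 𝓘(ℝ, E p) 𝓘(ℝ, Euc n →L[ℝ] Euc n) ((fun q => (E q).starProjection) ∘ s) 0 v =
      D (fun q => (E q).starProjection) p S := mfderiv_comp_apply_of_eq 0 hQd hsd hs0 v
  have h3 : f ∘ s =ᶠ[𝓝 0] fun v => f p + (E p).subtypeL v :=
    eventually_of_mem hnh fun v hv => (h v hv).1
  have h4 : (fun q => (E q).starProjection) ∘ s =ᶠ[𝓝 0] fun _ => (E p).starProjection :=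
    eventually_of_mem hnh fun v hv => by simp only [Function.comp_apply, (h v hv).2]
  rw [mfderiv_eq_fderiv, h3.fderiv_eq, fderiv_const_add, ContinuousLinearMap.fderiv] at h1
  rw [mfderiv_eq_fderiv, h4.fderiv_eq, fderiv_const_apply] at h2
  have h5 : S = X := hf.2 p h1.symm
  rw [← h5, ← h2]
  rfl

variable [IsManifold 𝓘(ℝ, Euc 4) ∞ M]

theorem range_fderiv_comp_chart_symm (hf : IsSubmanifold f) (p : M) {x : Euc 4}
    (hx : x ∈ (chartAt (Euc 4) p).target) (v : Euc n) :
    v ∈ tangentPlane f ((chartAt (Euc 4) p).symm x) ↔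
      ∃ u, v = fderiv ℝ (f ∘ (chartAt (Euc 4) p).symm) x u := by
  have hfd := (hf.1 ((chartAt (Euc 4) p).symm x)).mdifferentiableAt (by simp)
  constructor
  · rintro ⟨X, rfl⟩
    obtain ⟨u, rfl⟩ := (chart_symm_bijective p hx).2 X
    exact ⟨u, (fderiv_comp_chart_symm p hx hfd u).symm⟩
  · rintro ⟨u, rfl⟩
    exact ⟨_, (fderiv_comp_chart_symm p hx hfd u).symm⟩

/-- The second fundamental form is the derivative of the tangent projection. -/
theorem secondFundForm_eq (hf : IsSubmanifold f) (hJ : IsOrthogonalComplexStructure f J) (p : M)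
    (X Y : TangentSpace 𝓘(ℝ, Euc 4) p) :
    secondFundForm f p X Y = D (tangentProj J) p X (D f p Y) := by
  set c := chartAt (Euc 4) p with hc
  have hpt : c p ∈ c.target := mem_chart_target (Euc 4) p
  have hps : c.symm (c p) = p := c.left_inv (mem_chart_source (Euc 4) p)
  have hnh : c.target ∈ 𝓝 (c p) := c.open_target.mem_nhds hpt
  have hφ : ContDiffAt ℝ ∞ (f ∘ c.symm) (c p) := (contDiffOn_comp_chart_symm p hf.1).contDiffAt hnh
  have hP : ContDiffAt ℝ ∞ (tangentProj J ∘ c.symm) (c p) :=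
    (contDiffOn_comp_chart_symm p hJ.contMDiff_tangentProj).contDiffAt hnh
  have key := fderiv_proj_add (hP.differentiableAt (by simp)).hasFDerivAt
    ((hφ.fderiv_right (m := ∞) (by simp)).differentiableAt (by simp)).hasFDerivAt
    (eventually_of_mem hnh fun y hy v => by
      have h1 : fderiv ℝ (f ∘ c.symm) y v ∈ tangentPlane f (c.symm y) :=
        (range_fderiv_comp_chart_symm hf p hy _).mpr ⟨v, rfl⟩
      rw [Function.comp_apply, tangentProj_apply, hJ.sq _ _ h1, neg_neg]) X Y
  rw [Function.comp_apply, hps] at key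
  rw [D_eq_fderiv ((hJ.contMDiff_tangentProj p).mdifferentiableAt (by simp)),
    D_eq_fderiv ((hf.1 p).mdifferentiableAt (by simp)), secondFundForm,
    Submodule.starProjection_orthogonal_val, ← hJ.tangentProj_eq]
  exact (eq_sub_of_add_eq key).symm

/-- Type A, as the symmetry `II(X, J Y) = II(Y, J X)`. -/
theorem typeA_deriv (hf : IsSubmanifold f) (hJ : IsOrthogonalComplexStructure f J)
    (hT : IsTypeA f J) (p : M) (X Y : TangentSpace 𝓘(ℝ, Euc 4) p) :
    D (tangentProj J) p X (J p (D f p Y)) = D (tangentProj J) p Y (J p (D f p X)) := by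
  obtain ⟨b, hb, hbJ, hQ⟩ := hT p
  have key : ∀ k j, D (tangentProj J) p (b k) (J p (D f p (b j))) =
      D (tangentProj J) p (b j) (J p (D f p (b k))) := by
    intro k j
    have e : ∀ k j, D (tangentProj J) p (b k) (J p (D f p (b j))) =
        ∑ i, stdJ i j • secondFundForm f p (b k) (b i) := fun k j => by
      simp only [hbJ, map_sum, map_smul, secondFundForm_eq hf hJ]
    rw [e, e, ← sub_eq_zero, ← inner_self_eq_zero (𝕜 := ℝ)]
    have hmem : ∀ k j, ∑ i, stdJ i j • secondFundForm f p (b k) (b i) ∈ (tangentPlane f p)ᗮ :=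
      fun k j => Submodule.sum_mem _ fun i _ =>
        Submodule.smul_mem _ _ (secondFundForm_mem f p _ _)
    obtain ⟨hs, hJQ⟩ := hQ _ (Submodule.sub_mem _ (hmem k j) (hmem j k))
    set ν := ∑ i, stdJ i j • secondFundForm f p (b k) (b i) -
      ∑ i, stdJ i k • secondFundForm f p (b j) (b i)
    have h1 := congrFun (congrFun hJQ k) j
    rw [Matrix.neg_apply, Matrix.mul_apply, Matrix.mul_apply] at h1
    have h2 : ∀ i, stdJ k i = -stdJ i k := by
      intro i; fin_cases k <;> fin_cases i <;> simp [stdJ]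
    have h3 : ∀ i, secondFormMatrix f p b ν i j = secondFormMatrix f p b ν j i :=
      fun i => (hs.apply i j).symm
    simp only [h2, h3] at h1
    rw [inner_sub_left, sum_inner, sum_inner, sub_eq_zero]
    simp only [inner_smul_left]
    simp only [secondFormMatrix, Matrix.of_apply, neg_mul, Finset.sum_neg_distrib, neg_neg] at h1
    simpa [mul_comm] using h1
  have hspan : ∀ X, X ∈ Submodule.span ℝ (Set.range b) := fun X => by
    rw [hb.span_eq_top]; trivial
  have step : ∀ j, ∀ X, D (tangentProj J) p X (J p (D f p (b j))) =
      D (tangentProj J) p (b j) (J p (D f p X)) := by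
    intro j X
    induction hspan X using Submodule.span_induction with
    | mem x hx => obtain ⟨k, rfl⟩ := hx; exact key k j
    | zero => simp
    | add x y _ _ hx hy => simp only [map_add, _root_.add_apply, hx, hy]
    | smul a x _ hx => simp only [map_smul, _root_.smul_apply, hx]
  induction hspan Y using Submodule.span_induction with
  | mem x hx => obtain ⟨k, rfl⟩ := hx; exact step k X
  | zero => simp
  | add x y _ _ hx hy => simp only [map_add, _root_.add_apply, hx, hy]
  | smul a x _ hx => simp only [map_smul, _root_.smul_apply, hx]

/-- If `∇J = 0`, the derivative of `J` on tangent vectors is normal; tested on the tangent fields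
obtained by projecting constant vectors. -/
theorem parallel_deriv (hf : IsSubmanifold f) (hJ : IsOrthogonalComplexStructure f J)
    (hK : IsParallel f J) (p : M) (X Y : TangentSpace 𝓘(ℝ, Euc 4) p) :
    tangentProj J p (D J p X (D f p Y)) = 0 := by
  set v := D f p Y with hv
  have hJd := (hJ.smooth p).mdifferentiableAt (n := ∞) (by simp)
  have hPd := (hJ.contMDiff_tangentProj p).mdifferentiableAt (n := ∞) (by simp)
  have h1 := hK p X (fun q => tangentProj J q v)
    ((ContinuousLinearMap.apply ℝ (Euc n) v).contMDiff.contMDiffAt.comp p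
      (hJ.contMDiff_tangentProj p))
    (fun q => by rw [hJ.tangentProj_eq]; exact Submodule.starProjection_apply_mem _ _)
  simp only [hJ.J_tangentProj, covDeriv] at h1
  have h2 := D_clm_comp (ContinuousLinearMap.apply ℝ (Euc n) v) hJd X
  have h3 := D_clm_comp (ContinuousLinearMap.apply ℝ (Euc n) v) hPd X
  simp only [ContinuousLinearMap.apply_apply] at h2 h3
  rw [h2, h3, hv, ← secondFundForm_eq hf hJ,
    (Submodule.starProjection_apply_eq_zero_iff _).mpr (secondFundForm_mem f p X Y),
    map_zero] at h1
  rw [hJ.tangentProj_eq, h1]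

end Submanifold

/-! ### Ruled charts on the submanifold -/

section RuledCharts
open Filter Topology

/-- A non-zero vector `e` of an `A`-invariant plane on which `A² = -1` spans it together with
`A e`. -/
theorem exists_eq_smul_add_smul {W : Type*} [AddCommGroup W] [Module ℝ W] [FiniteDimensional ℝ W]
    {K : Submodule ℝ W} (hK : Module.finrank ℝ K = 2) (A : W →ₗ[ℝ] W) {e Z : W} (he : e ∈ K)
    (hAe : A e ∈ K) (hAA : A (A e) = -e) (h0 : e ≠ 0) (hZ : Z ∈ K) :
    ∃ a b : ℝ, Z = a • e + b • A e := by
  have hind : LinearIndependent ℝ ![e, A e] := by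
    rw [LinearIndependent.pair_iff]
    intro a b h
    have h2 := congrArg A h
    simp only [map_add, map_smul, hAA, map_zero] at h2
    have h3 : (a * a + b * b) • e = 0 := by
      have : (a * a + b * b) • e = a • (a • e + b • A e) - b • (a • A e + b • -e) := by
        module
      rw [this, h, h2]; simp
    have h4 : a * a + b * b = 0 := (smul_eq_zero.mp h3).resolve_right h0
    constructor <;> nlinarith [mul_self_nonneg a, mul_self_nonneg b]
  have hle : Submodule.span ℝ (Set.range ![e, A e]) ≤ K := by
    rw [Submodule.span_le]
    rintro _ ⟨i, rfl⟩
    fin_cases i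
    · exact he
    · exact hAe
  have heq := Submodule.eq_of_le_of_finrank_eq hle
    (by rw [finrank_span_eq_card hind, hK, Fintype.card_fin])
  rw [← heq, Matrix.range_cons, Matrix.range_cons, Matrix.range_empty, Set.union_empty,
    Set.singleton_union, Submodule.mem_span_pair] at hZ
  obtain ⟨a, b, h⟩ := hZ
  exact ⟨a, b, h.symm⟩

variable {n : ℕ} {M : Type*} [TopologicalSpace M] [ChartedSpace (Euc 4) M]
variable {f : M → Euc n} {J : M → Euc n →L[ℝ] Euc n} {E : M → Submodule ℝ (Euc n)}

theorem finrank_tangentPlane (hf : IsSubmanifold f) (p : M) :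
    Module.finrank ℝ (tangentPlane f p) = 4 := by
  rw [tangentPlane, LinearMap.finrank_range_of_inj (hf.2 p)]
  have : Module.finrank ℝ (TangentSpace 𝓘(ℝ, Euc 4) p) = Module.finrank ℝ (Euc 4) := rfl
  rw [this]; simp

/-- A skew operator that preserves `E` commutes with the projection to `E`. -/
theorem starProjection_comm (hJ : IsOrthogonalComplexStructure f J)
    (hJE : ∀ p, (E p).map (J p).toLinearMap = E p) (p : M) (Y : Euc n) :
    (E p).starProjection (J p Y) = J p ((E p).starProjection Y) := by
  have hm : ∀ e ∈ E p, J p e ∈ E p := fun e he => by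
    nth_rewrite 1 [← hJE p]; exact ⟨e, he, rfl⟩
  have h1 : J p (Y - (E p).starProjection Y) ∈ (E p)ᗮ := by
    rw [Submodule.mem_orthogonal]
    intro e he
    rw [real_inner_comm, hJ.skew,
      Submodule.inner_left_of_mem_orthogonal (hm e he) ((E p).sub_starProjection_mem_orthogonal Y),
      neg_zero]
  have h2 := (Submodule.starProjection_apply_eq_zero_iff _).mpr h1
  rw [map_sub, map_sub, sub_eq_zero] at h2
  rw [h2]
  exact Submodule.starProjection_eq_self_iff.mpr (hm _ ((E p).starProjection_apply_mem Y))

theorem finrank_orthogonal_inf (hf : IsSubmanifold f) (hE : IsTwoRuled f E) (p : M) :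
    Module.finrank ℝ ((E p)ᗮ ⊓ tangentPlane f p : Submodule ℝ (Euc n)) = 2 := by
  have h1 := Submodule.finrank_add_inf_finrank_orthogonal (hE.le_tangent p)
  rw [finrank_tangentPlane hf, hE.finrank_eq] at h1
  omega

theorem exists_ruledChart [IsManifold 𝓘(ℝ, Euc 4) ∞ M] (hf : IsSubmanifold f)
    (hJ : IsOrthogonalComplexStructure f J) (hT : IsTypeA f J)
    (hE : IsTwoRuled f E) (hJE : ∀ p, (E p).map (J p).toLinearMap = E p) (p : M) :
    ∃ Ω ⊆ (chartAt (Euc 4) p).target, chartAt (Euc 4) p p ∈ Ω ∧ ∃ G,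
      RuledChart Ω (f ∘ (chartAt (Euc 4) p).symm) G (J ∘ (chartAt (Euc 4) p).symm)
        ((fun q => (E q).starProjection) ∘ (chartAt (Euc 4) p).symm) := by
  set c := chartAt (Euc 4) p with hc
  have hpt : c p ∈ c.target := mem_chart_target (Euc 4) p
  have hφ := contDiffOn_comp_chart_symm p hf.1
  have hP := contDiffOn_comp_chart_symm p hJ.contMDiff_tangentProj
  have hφ' : ContDiffOn ℝ ∞ (fderiv ℝ (f ∘ c.symm)) c.target :=
    hφ.fderiv_of_isOpen c.open_target (by simp)
  have hfd : ∀ q, MDifferentiableAt 𝓘(ℝ, Euc 4) 𝓘(ℝ, Euc n) f q := fun q =>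
    (hf.1 q).mdifferentiableAt (by simp)
  have hinj : Function.Injective (fderiv ℝ (f ∘ c.symm) (c p)) := by
    intro u v huv
    rw [fderiv_comp_chart_symm p hpt (hfd _), fderiv_comp_chart_symm p hpt (hfd _)] at huv
    exact (chart_symm_bijective p hpt).1 (hf.2 _ huv)
  obtain ⟨G₀, hG₀⟩ := (fderiv ℝ (f ∘ c.symm) (c p)).toLinearMap.exists_leftInverse_of_injective
    (LinearMap.ker_eq_bot.mpr hinj)
  -- Near `c p`, a left inverse of the differential at `c p` can be corrected to a left inverse.
  let H : Euc 4 → Euc 4 →L[ℝ] Euc 4 := fun x =>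
    LinearMap.toContinuousLinearMap G₀ ∘L fderiv ℝ (f ∘ c.symm) x
  have hH : ContDiffOn ℝ ∞ H c.target := contDiffOn_const.clm_comp hφ'
  let Ω := c.target ∩ H ⁻¹' Set.range ((↑) : (Euc 4 ≃L[ℝ] Euc 4) → Euc 4 →L[ℝ] Euc 4)
  have hΩ : IsOpen Ω := hH.continuousOn.isOpen_inter_preimage c.open_target
    ContinuousLinearEquiv.isOpen
  have hsub : Ω ⊆ c.target := Set.inter_subset_left
  have hHinv : ∀ x ∈ Ω, (H x).IsInvertible := fun x hx => hx.2
  have hrange : ∀ x ∈ Ω, ∀ v, v ∈ tangentPlane f (c.symm x) ↔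
      ∃ u, v = fderiv ℝ (f ∘ c.symm) x u := fun x hx v =>
    range_fderiv_comp_chart_symm hf p (hsub hx) v
  have hmem : ∀ x ∈ Ω, ∀ u, fderiv ℝ (f ∘ c.symm) x u ∈ tangentPlane f (c.symm x) :=
    fun x hx u => (hrange x hx _).mpr ⟨u, rfl⟩
  have hP' : ∀ x, tangentProj (J ∘ c.symm) x = tangentProj J (c.symm x) := fun x => rfl
  have hJm : ∀ q, ∀ e ∈ E q, J q e ∈ E q := fun q e he => by
    nth_rewrite 1 [← hJE q]; exact ⟨e, he, rfl⟩
  refine ⟨Ω, hsub, ⟨hpt, ⟨ContinuousLinearEquiv.refl ℝ _, ?_⟩⟩,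
    fun x => ((H x).inverse ∘L LinearMap.toContinuousLinearMap G₀) ∘L
      tangentProj (J ∘ c.symm) x, ?_⟩
  · ext1 u
    exact (LinearMap.congr_fun hG₀ u).symm
  refine
    { isOpen := hΩ
      smooth_φ := hφ.mono hsub
      smooth_G := ?_
      smooth_J := (contDiffOn_comp_chart_symm p hJ.smooth).mono hsub
      smooth_Q := (contDiffOn_comp_chart_symm p hE.smooth).mono hsub
      G_fderiv := ?_
      G_proj := ?_
      J_skew := fun x _ => hJ.skew _
      J_range := fun x hx Y => (hrange x hx _).mp (hJ.J_mem _ Y)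
      J_sq := fun x hx u => hJ.sq _ _ (hmem x hx u)
      Q_symm := fun x _ Y Z => Submodule.inner_starProjection_left_eq_right _ Y Z
      Q_idem := fun x _ Y => Submodule.starProjection_eq_self_iff.mpr
        (Submodule.starProjection_apply_mem _ Y)
      Q_range := fun x hx Y => (hrange x hx _).mp
        (hE.le_tangent _ (Submodule.starProjection_apply_mem _ Y))
      comm := fun x _ Y => starProjection_comm hJ hJE _ Y
      span_E := ?_
      span_F := ?_
      ruled := ?_
      typeA := ?_ }
  · refine ContDiffOn.clm_comp (ContDiffOn.clm_comp ?_ contDiffOn_const) (hP.mono hsub)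
    intro x hx
    exact (((hHinv x hx).contDiffAt_map_inverse).comp_contDiffWithinAt x (hH x hx.1)).mono hsub
  · intro x hx u
    have h1 : tangentProj J (c.symm x) (fderiv ℝ (f ∘ c.symm) x u) =
        fderiv ℝ (f ∘ c.symm) x u := by
      rw [tangentProj_apply, hJ.sq _ _ (hmem x hx u), neg_neg]
    rw [ContinuousLinearMap.comp_apply, hP', h1]
    exact (hHinv x hx).inverse_apply_eq.mpr rfl
  · intro x hx Y
    have h1 : tangentProj J (c.symm x) (tangentProj J (c.symm x) Y) =
        tangentProj J (c.symm x) Y := by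
      rw [tangentProj_apply, hJ.J_tangentProj, tangentProj_apply]
    rw [ContinuousLinearMap.comp_apply, hP', h1]
    rfl
  · intro x hx e Z he h0 hZ
    have he' := Submodule.starProjection_eq_self_iff.mp he
    exact exists_eq_smul_add_smul (hE.finrank_eq (c.symm x)) (J (c.symm x)).toLinearMap he'
      (hJm _ _ he') (hJ.sq _ _ (hE.le_tangent _ he')) h0
      (Submodule.starProjection_eq_self_iff.mp hZ)
  · intro x hx v Z hv hvt h0 hZ hZt
    have hm : ∀ v, (E (c.symm x)).starProjection v = 0 →
        J (c.symm x) (J (c.symm x) v) = -v → v ∈ (E (c.symm x))ᗮ ⊓ tangentPlane f (c.symm x) :=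
      fun v h1 h2 => ⟨(Submodule.starProjection_apply_eq_zero_iff _).mp h1,
        (hJ.mem_iff _ v).mpr h2⟩
    refine exists_eq_smul_add_smul (finrank_orthogonal_inf hf hE (c.symm x))
      (J (c.symm x)).toLinearMap (hm v hv hvt) (hm _ ?_ ?_) hvt h0 (hm Z hZ hZt)
    · exact (starProjection_comm hJ hJE _ v).trans (by
        rw [Function.comp_apply] at hv; rw [hv, map_zero])
    · exact hJ.sq _ _ (hJ.J_mem _ v)
  · intro x hx u hu
    ext1 w
    have hu' := Submodule.starProjection_eq_self_iff.mp hu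
    rw [fderiv_comp_chart_symm p (hsub hx) (hfd _)] at hu'
    rw [fderiv_comp_chart_symm p (hsub hx) ((hE.smooth _).mdifferentiableAt (by simp)),
      ruled_deriv hf hE _ _ hu']
  · intro x hx u v
    have hPd := (hJ.contMDiff_tangentProj (c.symm x)).mdifferentiableAt (n := ∞) (by simp)
    have h1 : ∀ u, fderiv ℝ (tangentProj (J ∘ c.symm)) x u = D (tangentProj J) (c.symm x)
        (mfderiv 𝓘(ℝ, Euc 4) 𝓘(ℝ, Euc 4) c.symm x u) := fun u =>
      fderiv_comp_chart_symm p (hsub hx) hPd u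
    rw [h1, h1, fderiv_comp_chart_symm p (hsub hx) (hfd _),
      fderiv_comp_chart_symm p (hsub hx) (hfd _)]
    exact typeA_deriv hf hJ hT _ _ _

/-- The form `ν · II` depends only on the projection of `ν` to a space that contains the values
of `II`. -/
theorem finrank_secondFormSpace_le {p : M} {K : Submodule ℝ (Euc n)}
    (h : ∀ X Y, secondFundForm f p X Y ∈ K) :
    Module.finrank ℝ (secondFormSpace f p) ≤ Module.finrank ℝ K := by
  let Λ : Euc n →ₗ[ℝ] (TangentSpace 𝓘(ℝ, Euc 4) p → TangentSpace 𝓘(ℝ, Euc 4) p → ℝ) :=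
    { toFun := fun ν X Y => ⟪secondFundForm f p X Y, ν⟫
      map_add' := fun ν ν' => by ext X Y; exact inner_add_right _ _ _
      map_smul' := fun a ν => by ext X Y; exact inner_smul_right _ _ _ }
  have hle : secondFormSpace f p ≤ K.map Λ := by
    refine Submodule.span_le.mpr ?_
    rintro _ ⟨ν, -, rfl⟩
    refine ⟨K.starProjection ν, K.starProjection_apply_mem ν, ?_⟩
    ext X Y
    change ⟪secondFundForm f p X Y, K.starProjection ν⟫ = ⟪secondFundForm f p X Y, ν⟫
    rw [← Submodule.inner_starProjection_left_eq_right,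
      Submodule.starProjection_eq_self_iff.mpr (h X Y)]
  exact (Submodule.finrank_mono hle).trans (Submodule.finrank_map_le Λ K)

theorem frequently_chart_symm_mem {U : Set M} (hU : Dense U) (p : M) {x : Euc 4}
    (hx : x ∈ (chartAt (Euc 4) p).target) : ∃ᶠ y in 𝓝 x, (chartAt (Euc 4) p).symm y ∈ U := by
  have h := mem_closure_iff_frequently.mp (hU ((chartAt (Euc 4) p).symm x))
  rw [← (chartAt (Euc 4) p).symm.map_nhds_eq hx] at h
  exact frequently_map.mp h


variable [IsManifold 𝓘(ℝ, Euc 4) ∞ M]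

theorem secondFundForm_mem_of_bform (hf : IsSubmanifold f)
    (hJ : IsOrthogonalComplexStructure f J) (p : M) {Ω : Set (Euc 4)}
    (hΩ : Ω ⊆ (chartAt (Euc 4) p).target) {G : Euc 4 → Euc n →L[ℝ] Euc 4}
    {Q : Euc 4 → Euc n →L[ℝ] Euc n}
    (h : RuledChart Ω (f ∘ (chartAt (Euc 4) p).symm) G (J ∘ (chartAt (Euc 4) p).symm) Q)
    {y : Euc 4} (hy : y ∈ Ω) {K : Submodule ℝ (Euc n)}
    (hK : ∀ X Y, bform G (J ∘ (chartAt (Euc 4) p).symm) y X Y ∈ K)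
    (X Y : TangentSpace 𝓘(ℝ, Euc 4) ((chartAt (Euc 4) p).symm y)) :
    secondFundForm f ((chartAt (Euc 4) p).symm y) X Y ∈ K := by
  obtain ⟨u, rfl⟩ := (chart_symm_bijective p (hΩ hy)).2 X
  obtain ⟨v, rfl⟩ := (chart_symm_bijective p (hΩ hy)).2 Y
  have h1 := fderiv_comp_chart_symm p (hΩ hy)
    ((hJ.contMDiff_tangentProj ((chartAt (Euc 4) p).symm y)).mdifferentiableAt (by simp)) u
  have h2 := fderiv_comp_chart_symm p (hΩ hy)
    ((hf.1 ((chartAt (Euc 4) p).symm y)).mdifferentiableAt (by simp)) v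
  rw [secondFundForm_eq hf hJ, ← h1, ← h2]
  have h3 := hK (fderiv ℝ (f ∘ (chartAt (Euc 4) p).symm) y u)
    (fderiv ℝ (f ∘ (chartAt (Euc 4) p).symm) y v)
  rwa [h.bform_eq hy (h.proj_fderiv hy u) (h.proj_fderiv hy v)] at h3

/-- The obstruction vanishes: by density and continuity it is enough to treat points where
`dim |II| = δ`, and these fall under one of the two cases. -/
theorem defect_chart_eq_zero {δ : ℕ} (hf : IsSubmanifold f) (hδ : HasNormalRank f δ) (hδ1 : 1 ≤ δ)
    (hJ : IsOrthogonalComplexStructure f J)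
    (hK : δ ≤ 2 → IsParallel f J) (p : M) {Ω : Set (Euc 4)}
    (hΩ : Ω ⊆ (chartAt (Euc 4) p).target) {G : Euc 4 → Euc n →L[ℝ] Euc 4}
    {Q : Euc 4 → Euc n →L[ℝ] Euc n}
    (h : RuledChart Ω (f ∘ (chartAt (Euc 4) p).symm) G (J ∘ (chartAt (Euc 4) p).symm) Q)
    {x : Euc 4} (hx : x ∈ Ω) {Y e : Euc n}
    (hY : J ((chartAt (Euc 4) p).symm x) (J ((chartAt (Euc 4) p).symm x) Y) = -Y)
    (he : Q x e = e) :
    RuledJet.defect (J ((chartAt (Euc 4) p).symm x)) (fderiv ℝ Q x ∘L G x) Y e = 0 := by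
  obtain ⟨U, -, hU, hrank⟩ := hδ
  have hfreq : ∀ x ∈ Ω, ∃ᶠ y in 𝓝 x, y ∈ Ω ∧ (chartAt (Euc 4) p).symm y ∈ U := fun x hx =>
    ((frequently_chart_symm_mem hU p (hΩ hx)).and_eventually (h.nhds hx)).mono fun y hy => hy.symm
  rcases le_or_gt δ 2 with hδ2 | hδ2
  · refine h.defect_eq_zero_of_parallel (fun x hx => (hfreq x hx).mono fun y hy => ?_) ?_ hx hY he
    · by_contra hc
      push Not at hc
      have := finrank_secondFormSpace_le (K := ⊥)
        (secondFundForm_mem_of_bform hf hJ p hΩ h hy.1 fun X Y => by rw [hc]; exact zero_mem _)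
      rw [hrank _ hy.2, finrank_bot] at this
      omega
    · intro y hy u v
      have h1 := fderiv_comp_chart_symm p (hΩ hy)
        ((hJ.smooth ((chartAt (Euc 4) p).symm y)).mdifferentiableAt (by simp)) u
      have h2 := fderiv_comp_chart_symm p (hΩ hy)
        ((hf.1 ((chartAt (Euc 4) p).symm y)).mdifferentiableAt (by simp)) v
      rw [h1, h2]
      exact parallel_deriv hf hJ (hK hδ2) _ _ _
  · refine h.defect_eq_zero_of_span (fun x hx => (hfreq x hx).mono fun y hy => ?_) hx hY he
    by_contra hc
    push Not at hc
    obtain ⟨n₁, n₂, hn⟩ := hc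
    have h1 := finrank_secondFormSpace_le (secondFundForm_mem_of_bform hf hJ p hΩ h hy.1 hn)
    have h2 : Module.finrank ℝ (Submodule.span ℝ {n₁, n₂}) ≤ 2 := by
      have := finrank_span_le_card (R := ℝ) ({n₁, n₂} : Set (Euc n))
      refine this.trans ?_
      rw [Set.toFinset_insert, Set.toFinset_singleton]
      exact Finset.card_le_two
    rw [hrank _ hy.2] at h1
    omega

/-- At `e ∈ E`, the differential of the field of ruling planes intertwines `J` on the directions
with `J` on `E`, and the derivative of the rotation `J Q` at `e` equals that of `Q` at `J e`. -/
theorem deriv_starProjection {δ : ℕ} (hf : IsSubmanifold f) (hδ : HasNormalRank f δ) (hδ1 : 1 ≤ δ)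
    (hJ : IsOrthogonalComplexStructure f J) (hT : IsTypeA f J) (hK : δ ≤ 2 → IsParallel f J)
    (hE : IsTwoRuled f E) (hJE : ∀ p, (E p).map (J p).toLinearMap = E p) (p : M)
    {e : Euc n} (he : e ∈ E p) :
    (∀ X JX : TangentSpace 𝓘(ℝ, Euc 4) p, D f p JX = J p (D f p X) →
      D (fun q => (E q).starProjection) p JX e = D (fun q => (E q).starProjection) p X (J p e)) ∧
    ∀ X : TangentSpace 𝓘(ℝ, Euc 4) p,
      D (fun q => J q ∘L (E q).starProjection) p X e =
        D (fun q => (E q).starProjection) p X (J p e) := by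
  obtain ⟨Ω, hΩ, hp, G, h⟩ := exists_ruledChart hf hJ hT hE hJE p
  set c := chartAt (Euc 4) p
  have hps : c.symm (c p) = p := c.left_inv (mem_chart_source (Euc 4) p)
  have hfd : D f p = fderiv ℝ (f ∘ c.symm) (c p) :=
    D_eq_fderiv ((hf.1 p).mdifferentiableAt (by simp))
  have hQd : D (fun q => (E q).starProjection) p =
      fderiv ℝ ((fun q => (E q).starProjection) ∘ c.symm) (c p) :=
    D_eq_fderiv ((hE.smooth p).mdifferentiableAt (by simp))
  have hRd : D (fun q => J q ∘L (E q).starProjection) p =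
      fderiv ℝ ((fun q => J q ∘L (E q).starProjection) ∘ c.symm) (c p) :=
    D_eq_fderiv (((hJ.smooth p).clm_comp (hE.smooth p)).mdifferentiableAt (by simp))
  have he' : ((fun q => (E q).starProjection) ∘ c.symm) (c p) e = e := by
    rw [Function.comp_apply, hps]
    exact Submodule.starProjection_eq_self_iff.mpr he
  have hG : ∀ X : TangentSpace 𝓘(ℝ, Euc 4) p, G (c p) (D f p X) = X := fun X => by
    rw [hfd]; exact h.G_fderiv _ hp X
  constructor
  · intro X JX hX
    have hY : J (c.symm (c p)) (J (c.symm (c p)) (D f p X)) = -D f p X := by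
      rw [hps]; exact hJ.sq p _ ⟨X, rfl⟩
    have := defect_chart_eq_zero hf hδ hδ1 hJ hK p hΩ h hp hY he'
    rw [RuledJet.defect, sub_eq_zero, hps, ← hX, ContinuousLinearMap.comp_apply,
      ContinuousLinearMap.comp_apply, hG, hG] at this
    rw [hQd]
    exact this
  · intro X
    have h1 := (h.jet hp).Q'_J (D f p X) he'
    rw [ContinuousLinearMap.comp_apply, ContinuousLinearMap.comp_apply, hG, Function.comp_apply,
      hps] at h1
    have h2 := (h.hasFDerivAt_J hp).clm_comp (h.hasFDerivAt_Q hp)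
    have h3 : ∀ u : Euc 4, fderiv ℝ ((fun q => J q ∘L (E q).starProjection) ∘ c.symm) (c p) u e =
        J p (fderiv ℝ ((fun q => (E q).starProjection) ∘ c.symm) (c p) u e) +
          fderiv ℝ (J ∘ c.symm) (c p) u e := by
      intro u
      have h4 := DFunLike.congr_fun (DFunLike.congr_fun h2.fderiv u) e
      simp only [_root_.add_apply, ContinuousLinearMap.comp_apply,
        ContinuousLinearMap.flip_apply, ContinuousLinearMap.compL_apply, he'] at h4
      rw [Function.comp_apply, hps] at h4
      exact h4
    rw [hRd, hQd]
    exact (h3 X).trans ((add_comm _ _).trans h1.symm)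

end RuledCharts

/-! ### The Gauss map of the ruling -/

section Gauss
open Filter Topology

/-- The `k`-th homogeneous coordinate of the plane `E_q`, oriented by `J`, that is obtained from
the orthogonal projection to `E_q` of the fixed vector `e`. -/
def isoCoord {n : ℕ} {M : Type*} (J : M → Euc n →L[ℝ] Euc n) (E : M → Submodule ℝ (Euc n))
    (e : Euc n) (k : Fin n) (q : M) : ℂ :=
  ((E q).starProjection e k : ℂ) - Complex.I * (J q ((E q).starProjection e) k : ℂ)

/-- The evaluation functional `A ↦ (A e)_k`, with complex values. -/
def evalCoord {n : ℕ} (e : Euc n) (k : Fin n) : (Euc n →L[ℝ] Euc n) →L[ℝ] ℂ :=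
  Complex.ofRealCLM ∘L EuclideanSpace.proj k ∘L ContinuousLinearMap.apply ℝ (Euc n) e

/-- The functional through which `isoCoord` depends on the pair of projection and rotation of
the plane. -/
def isoFunctional {n : ℕ} (e : Euc n) (k : Fin n) :
    (Euc n →L[ℝ] Euc n) × (Euc n →L[ℝ] Euc n) →L[ℝ] ℂ :=
  evalCoord e k ∘L ContinuousLinearMap.fst ℝ _ _ -
    Complex.I • (evalCoord e k ∘L ContinuousLinearMap.snd ℝ _ _)

theorem isoCoord_eq {n : ℕ} {M : Type*} (J : M → Euc n →L[ℝ] Euc n)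
    (E : M → Submodule ℝ (Euc n)) (e : Euc n) (k : Fin n) : isoCoord J E e k = fun q =>
      isoFunctional e k ((E q).starProjection, J q ∘L (E q).starProjection) := rfl

variable {n : ℕ} {M : Type*} [TopologicalSpace M] [ChartedSpace (Euc 4) M]
variable {f : M → Euc n} {J : M → Euc n →L[ℝ] Euc n} {E : M → Submodule ℝ (Euc n)}

/-- The field of planes `E`, oriented by `J`. -/
def orientedPlane (hJ : IsOrthogonalComplexStructure f J) (hE : IsTwoRuled f E)
    (hJE : ∀ p, (E p).map (J p).toLinearMap = E p) (p : M) : Gr2 n where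
  plane := E p
  finrank_plane := hE.finrank_eq p
  rot :=
    { toLinearMap := (J p).toLinearMap.restrict fun e he => by
        nth_rewrite 1 [← hJE p]; exact ⟨e, he, rfl⟩
      norm_map' := fun v => hJ.isometry p v (hE.le_tangent p v.2) }
  rot_rot v := Subtype.ext (hJ.sq p v (hE.le_tangent p v.2))

theorem contMDiff_pair (hJ : IsOrthogonalComplexStructure f J) (hE : IsTwoRuled f E) :
    ContMDiff 𝓘(ℝ, Euc 4) 𝓘(ℝ, (Euc n →L[ℝ] Euc n) × (Euc n →L[ℝ] Euc n)) ∞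
      (fun q => ((E q).starProjection, J q ∘L (E q).starProjection)) :=
  hE.smooth.prodMk_space (hJ.smooth.clm_comp hE.smooth)

theorem contMDiff_isoCoord (hJ : IsOrthogonalComplexStructure f J) (hE : IsTwoRuled f E)
    (e : Euc n) (k : Fin n) : ContMDiff 𝓘(ℝ, Euc 4) 𝓘(ℝ, ℂ) ∞ (isoCoord J E e k) := by
  rw [isoCoord_eq]
  exact (isoFunctional e k).contMDiff.comp (contMDiff_pair hJ hE)

theorem D_isoCoord (hJ : IsOrthogonalComplexStructure f J) (hE : IsTwoRuled f E)
    (e : Euc n) (k : Fin n) (p : M) (X : TangentSpace 𝓘(ℝ, Euc 4) p) :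
    D (isoCoord J E e k) p X = (D (fun q => (E q).starProjection) p X e k : ℂ) -
      Complex.I * (D (fun q => J q ∘L (E q).starProjection) p X e k : ℂ) := by
  have hp := (contMDiff_pair hJ hE p).mdifferentiableAt (by simp)
  have h1 := D_clm_comp (ContinuousLinearMap.fst ℝ _ _) hp X
  have h2 := D_clm_comp (ContinuousLinearMap.snd ℝ _ _) hp X
  simp only [ContinuousLinearMap.coe_fst', ContinuousLinearMap.coe_snd'] at h1 h2
  rw [isoCoord_eq, D_clm_comp (isoFunctional e k) hp X, h1, h2]
  rfl

/-- The product rule. -/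
theorem D_eq_of_mul_eventuallyEq {a b h : M → ℂ} {p : M}
    (hb : MDifferentiableAt 𝓘(ℝ, Euc 4) 𝓘(ℝ, ℂ) b p)
    (hh : MDifferentiableAt 𝓘(ℝ, Euc 4) 𝓘(ℝ, ℂ) h p)
    (heq : a =ᶠ[𝓝 p] fun q => h q * b q) (X : TangentSpace 𝓘(ℝ, Euc 4) p) :
    D a p X = h p * D b p X + b p * D h p X := by
  have h1 := (hh.hasMFDerivAt.mul hb.hasMFDerivAt).mfderiv
  have h2 : D a p = _ := heq.mfderiv_eq.trans h1
  rw [h2]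
  rfl

theorem isHolomorphic_orientedPlane [IsManifold 𝓘(ℝ, Euc 4) ∞ M] {δ : ℕ} (hf : IsSubmanifold f)
    (hδ : HasNormalRank f δ) (hδ1 : 1 ≤ δ)
    (hJ : IsOrthogonalComplexStructure f J) (hT : IsTypeA f J) (hK : δ ≤ 2 → IsParallel f J)
    (hE : IsTwoRuled f E) (hJE : ∀ p, (E p).map (J p).toLinearMap = E p) :
    IsHolomorphic f J (orientedPlane hJ hE hJE) := by
  intro p j hj k
  obtain ⟨⟨e, he⟩, he0⟩ := (orientedPlane hJ hE hJE p).exists_ne_zero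
  change e ∈ E p at he
  have he0' : e ≠ 0 := fun h => he0 (Subtype.ext h)
  have heE : (E p).starProjection e = e := Submodule.starProjection_eq_self_iff.mpr he
  -- homogeneous coordinates of the plane at nearby points, from the projections of `e`
  have hcoord : ∀ q, (hq : (E q).starProjection e ≠ 0) → ∀ k l,
      affineCoord l k (orientedPlane hJ hE hJE q).toQuadric =
        isoCoord J E e k q / isoCoord J E e l q := by
    intro q hq k l
    rw [Gr2.toQuadric_eq (orientedPlane hJ hE hJE q)
      (e := ⟨(E q).starProjection e, (E q).starProjection_apply_mem e⟩)
      (fun h => hq (congrArg Subtype.val h)), affineCoord_mk]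
    rfl
  have hne : ∀ᶠ q in 𝓝 p, (E q).starProjection e ≠ 0 := by
    have hc : ContinuousAt (fun q => (E q).starProjection e) p :=
      (hE.smooth.continuous.clm_apply continuous_const).continuousAt
    exact hc.eventually_ne (by rwa [heE])
  have hsm := contMDiff_isoCoord hJ hE e
  have hj0 : isoCoord J E e j p ≠ 0 := by
    rw [Gr2.toQuadric_eq (orientedPlane hJ hE hJE p) he0] at hj
    obtain ⟨a, ha⟩ := Projectivization.exists_smul_eq_mk_rep ℂ _
      ((orientedPlane hJ hE hJE p).isoVec_ne_zero he0)
    rw [← ha] at hj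
    intro h0
    apply hj
    have h1 : (orientedPlane hJ hE hJE p).isoVec ⟨e, he⟩ j = isoCoord J E e j p := by
      rw [isoCoord, heE]; rfl
    rw [Pi.smul_apply, h1, h0, smul_zero]
  have hjne : ∀ᶠ q in 𝓝 p, isoCoord J E e j q ≠ 0 :=
    (hsm j).continuous.continuousAt.eventually_ne hj0
  have hsmooth : ContMDiffAt 𝓘(ℝ, Euc 4) 𝓘(ℝ, ℂ) ∞
      (fun q => affineCoord j k (orientedPlane hJ hE hJE q).toQuadric) p := by
    refine ContMDiffAt.congr_of_eventuallyEq ?_ (hne.mono fun q hq => hcoord q hq k j)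
    have hdiv : ContDiffAt ℝ ∞ (fun z : ℂ × ℂ => z.1 * z.2⁻¹)
        (isoCoord J E e k p, isoCoord J E e j p) :=
      contDiffAt_fst.mul (contDiffAt_snd.inv hj0)
    exact hdiv.contMDiffAt.comp p (((hsm k) p).prodMk_space ((hsm j) p))
  refine ⟨hsmooth, fun X JX hX => ?_⟩
  obtain ⟨hd1, hd2⟩ := deriv_starProjection hf hδ hδ1 hJ hT hK hE hJE p he
  have hJe : J p e ∈ E p := by nth_rewrite 1 [← hJE p]; exact ⟨e, he, rfl⟩
  have hd3 := (deriv_starProjection hf hδ hδ1 hJ hT hK hE hJE p hJe).1 X JX hX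
  rw [hJ.sq p e (hE.le_tangent p he), map_neg] at hd3
  -- the homogeneous coordinates themselves satisfy the Cauchy-Riemann equation at `p`
  have hCR : ∀ l, D (isoCoord J E e l) p JX = Complex.I * D (isoCoord J E e l) p X := by
    intro l
    rw [D_isoCoord hJ hE, D_isoCoord hJ hE, hd2, hd2, hd3, hd1 X JX hX, PiLp.neg_apply]
    push_cast
    linear_combination
      (D (fun q => (E q).starProjection) p X (J p e) l : ℂ) * Complex.I_mul_I
  have hmul : isoCoord J E e k =ᶠ[𝓝 p] fun q =>
      affineCoord j k (orientedPlane hJ hE hJE q).toQuadric * isoCoord J E e j q := by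
    filter_upwards [hne, hjne] with q h1 h2
    rw [hcoord q h1, div_mul_cancel₀ _ h2]
  have hD := D_eq_of_mul_eventuallyEq (((hsm j) p).mdifferentiableAt (by simp))
    (hsmooth.mdifferentiableAt (by simp)) hmul
  have h1 := hD JX
  rw [hCR, hCR, hD X] at h1
  apply mul_left_cancel₀ hj0
  linear_combination -h1

end Gauss

end Austere
end

theorem mainTheorem6 {n : ℕ} {M : Type*} [TopologicalSpace M] [ChartedSpace (Euc 4) M]
    [IsManifold 𝓘(ℝ, Euc 4) ∞ M] [ConnectedSpace M]
    (f : M → Euc n) (J : M → Euc n →L[ℝ] Euc n) (E : M → Submodule ℝ (Euc n)) (δ : ℕ)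
    (hf : Austere.IsSubmanifold f) (hA : Austere.IsAustere f)
    (hδ : Austere.HasNormalRank f δ) (hδ1 : 1 ≤ δ)
    (hJ : Austere.IsOrthogonalComplexStructure f J) (hT : Austere.IsTypeA f J)
    (hK : δ ≤ 2 → Austere.IsParallel f J)
    (hE : Austere.IsTwoRuled f E) (hJE : ∀ p, (E p).map (J p).toLinearMap = E p) :
    ∃ γ : M → Austere.Gr2 n,
      (∀ p, (γ p).plane = E p ∧ ∀ v : (γ p).plane, ((γ p).rot v : Euc n) = J p v) ∧
        Austere.IsHolomorphic f J γ :=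
  ⟨Austere.orientedPlane hJ hE hJE, fun _ => ⟨rfl, fun _ => rfl⟩,
    Austere.isHolomorphic_orientedPlane hf hδ hδ1 hJ hT hK hE hJE⟩
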